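/- **Setting.** Let $d \in \mathbb{N}$ and let $\ell : [0,\infty)^d \to \mathbb{R}$ be a stable tail dependence function (stdf): there is a random vector $(X_1,\dots,X_d)$ with continuous marginal distribution functions $F_1,\dots,F_d$ such that, for every $x \in [0,\infty)^d$, $$\ell(x) = \lim_{t \downarrow 0} t^{-1}\, \mathbb{P}\{F_1(X_1) > 1 - t x_1 \text{ or } \dots \text{ or } F_d(X_d) > 1 - t x_d\}.$$ Let $k = k_n \in (0,n]$ be real numbers ($n \ge 1$). For each $n$ let $\hat\ell_{n,k}$ be a random real-valued function on $[0,n/k]^d$, defined on some probability space that may depend on $n$; nothing else is assumed about how it is constructed. For $x \in [0,n/k]^d$ let $\nu_{n,k,x}$ be the law of $(T_1/k,\dots,T_d/k)$, where $T_1,\dots,T_d$ are independent and $T_j \sim \operatorname{Bin}(n, \tfrac{k}{n} x_j)$, and put $$\hat\ell^{\beta}_{n,k}(x) = \int_{[0,n/k]^d} \hat\ell_{n,k}(y)\, \mathrm{d}\nu_{n,k,x}(y), \qquad x \in [0,n/k]^d.$$ For a set $T$, $\ell^\infty(T)$ is the Banach space of bounded functions $T \to \mathbb{R}$ with the supremum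 norm. Weak convergence $\leadsto$ in $\ell^\infty(T)$ is in the sense of Hoffmann-Jørgensen: the limit is Borel measurable and outer expectations of bounded continuous functionals converge to the expectation under the limit. The symbols $\mathrm{O}_{\mathbb{P}}$ and $\mathrm{o}_{\mathbb{P}}$ refer to outer probability. **Theorem.** Assume that $\log(n) = \mathrm{o}(k)$ and $k = \mathrm{o}(n)$ as $n \to \infty$, and that 1. for every $j \in \{1,\dots,d\}$, the function $\ell$ has a continuous first-order partial derivative $\partial \ell/\partial x_j$ on $\{x \in [0,\infty)^d : x_j > 0\}$; 2. $\sup_{y \in [0,n/k]^d} |\hat\ell_{n,k}(y)| = \mathrm{O}_{\mathbb{P}}(n/k)$ as $n \to \infty$; 3. there exist $\delta > 0$ and a stochastic process $B$ on $[0,1+\delta]^d$ with continuous trajectories such that $\sqrt{k}\,(\hat\ell_{n,k} - \ell) \leadsto B$ in $\ell^\infty([0,1+\delta]^d)$ as $n \to \infty$ (in particular, for all large $n$ the trajectories of $\hat\ell_{n,k}$ are bounded on $[0,1+\delta]^d$). Then, as $n \to \infty$, $$\sup_{x \in [0,1]^d} \bigl| \sqrt{k}\,(\hat\ell^{\beta}_{n,k}(x)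 - \ell(x)) - \sqrt{k}\,(\hat\ell_{n,k}(x) - \ell(x)) \bigr| = \mathrm{o}_{\mathbb{P}}(1),$$ and both $\sqrt{k}\,(\hat\ell_{n,k} - \ell) \leadsto B$ and $\sqrt{k}\,(\hat\ell^{\beta}_{n,k} - \ell) \leadsto B$ in $\ell^\infty([0,1]^d)$, where $B$ is restricted to $[0,1]^d$. -/

import Mathlib

open MeasureTheory ProbabilityTheory Filter Topology Asymptotics
open scoped ENNReal NNReal BoundedContinuousFunction

noncomputable section

namespace BetaStdf

/-- The cube `[0, M]^d`. -/
def cube (d : ℕ) (M : ℝ) : Set (Fin d → ℝ) := Set.Icc 0 (fun _ => M)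

/-- `l` is (on `[0, ∞)^d`) the stable tail dependence function of some probability law `F` on `ℝ^d`
with continuous marginal distribution functions `F_1, …, F_d`:
`l x = lim_{t ↓ 0} t⁻¹ P (F_1 (X_1) > 1 - t x_1 or … or F_d (X_d) > 1 - t x_d)` with `X ∼ F`,
the limit existing for every `x ∈ [0, ∞)^d`. -/
def IsStdf (d : ℕ) (l : (Fin d → ℝ) → ℝ) : Prop :=
  ∃ F : Measure (Fin d → ℝ), IsProbabilityMeasure F ∧
    (∀ j, Continuous (fun s : ℝ => cdf (F.map (fun X => X j)) s)) ∧
    ∀ x : Fin d → ℝ, 0 ≤ x →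
      Tendsto
        (fun t : ℝ =>
          t⁻¹ * F.real {X | ∃ j, 1 - t * x j < cdf (F.map (fun X => X j)) (X j)})
        (𝓝[>] 0) (𝓝 (l x))

/-- For every `j`, the function `l` has a continuous first-order partial derivative with respect to
the `j`-th variable on `{x ∈ [0, ∞)^d | x_j > 0}`. (Only values of `l` on `[0, ∞)^d` matter.) -/
def HasContPartials (d : ℕ) (l : (Fin d → ℝ) → ℝ) : Prop :=
  ∀ j : Fin d, ∃ l' : (Fin d → ℝ) → ℝ,
    ContinuousOn l' {x | 0 ≤ x ∧ 0 < x j} ∧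
    ∀ x : Fin d → ℝ, 0 ≤ x → 0 < x j →
      HasDerivAt (fun s : ℝ => l (Function.update x j s)) (l' x) (x j)

/-- The beta smoother `ν_{n,k,x}`: the law of `(T_1 / k, …, T_d / k)` where `T_1, …, T_d` are
independent and `T_j ∼ Bin(n, (k / n) x_j)`. It is used for `x ∈ [0, n / k]^d` only; there
`(k / n) x_j ∈ [0, 1]`, so that the projection to `[0, 1]` does nothing. -/
def betaSmoother {d : ℕ} (n : ℕ) (k : ℝ) (x : Fin d → ℝ) : Measure (Fin d → ℝ) :=
  Measure.pi fun j =>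
    (binomial n (Set.projIcc (0 : ℝ) 1 zero_le_one (k / n * x j))).map (fun t : ℕ => (t : ℝ) / k)

/-- `x ↦ ∫_{[0, n/k]^d} g(y) dν_{n,k,x}(y)`. The measure has finite support, hence the integral is
a finite sum and exists for every `g`. -/
def betaSmooth {d : ℕ} (n : ℕ) (k : ℝ) (g : (Fin d → ℝ) → ℝ) (x : Fin d → ℝ) : ℝ :=
  ∫ y in cube d ((n : ℝ) / k), g y ∂(betaSmoother n k x)

/-- The supremum of `|f|` over `S`, possibly infinite. -/
def supNorm {d : ℕ} (S : Set (Fin d → ℝ)) (f : (Fin d → ℝ) → ℝ) : ℝ≥0∞ := ⨆ x ∈ S, ‖f x‖ₑ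

section Stochastic

variable {Ω : ℕ → Type*} [∀ n, MeasurableSpace (Ω n)]

/-- `Z_n = o_P(1)`, in outer probability: `Z_n` need not be measurable, and the value of a
`Measure` at an arbitrary set is its outer measure. -/
def IsLittleOP (P : ∀ n, Measure (Ω n)) (Z : ∀ n, Ω n → ℝ≥0∞) : Prop :=
  ∀ ε : ℝ≥0∞, 0 < ε → Tendsto (fun n => P n {ω | ε ≤ Z n ω}) atTop (𝓝 0)

/-- `Z_n = O_P(a_n)` as `n → ∞`, in outer probability. -/
def IsBigOP (P : ∀ n, Measure (Ω n)) (Z : ∀ n, Ω n → ℝ≥0∞) (a : ℕ → ℝ) : Prop :=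
  ∀ ε : ℝ≥0∞, 0 < ε → ∃ M : ℝ≥0, ∀ᶠ n in atTop, P n {ω | M * ENNReal.ofReal (a n) < Z n ω} ≤ ε

/-- Outer expectation `E^* f = inf {E U | U ≥ f, U measurable with finite expectation}` of a bounded,
not necessarily measurable function `f` on a probability space. -/
def outerExp {A : Type*} [MeasurableSpace A] (P : Measure A) (f : A → ℝ) : ℝ :=
  sInf {r : ℝ | ∃ U : A → ℝ, Measurable U ∧ Integrable U P ∧ (∀ ω, f ω ≤ U ω) ∧ r = ∫ ω, U ω ∂P}

/-- Weak convergence in the sense of Hoffmann-Jørgensen: the limit is Borel measurable and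
`E^* f(X_n) → E f(X)` for all bounded continuous `f`. -/
def WeakConv {E : Type*} [PseudoMetricSpace E] (P : ∀ n, Measure (Ω n)) (X : ∀ n, Ω n → E)
    {Ω' : Type*} [MeasurableSpace Ω'] (Q : Measure Ω') (Y : Ω' → E) : Prop :=
  Measurable[_, borel E] Y ∧
    ∀ f : E →ᵇ ℝ,
      Tendsto (fun n => outerExp (P n) (fun ω => f (X n ω))) atTop (𝓝 (∫ ω, f (Y ω) ∂Q))

/-- The Banach space `ℓ^∞(S)` of bounded real functions on `S`, with the supremum norm. -/
abbrev Linf {d : ℕ} (S : Set (Fin d → ℝ)) : Type := lp (fun _ : S => ℝ) ∞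

/-- `f` is bounded on `S`, that is, its restriction belongs to `ℓ^∞(S)`. -/
def BddOnSet {d : ℕ} (S : Set (Fin d → ℝ)) (f : (Fin d → ℝ) → ℝ) : Prop :=
  Memℓp (E := fun _ : S => ℝ) (fun x => f x) ∞

open Classical in
/-- The restriction of `f` to `S` as an element of `ℓ^∞(S)` (zero if `f` is unbounded on `S`). -/
def toLinf {d : ℕ} (S : Set (Fin d → ℝ)) (f : (Fin d → ℝ) → ℝ) : Linf S :=
  if h : BddOnSet S f then ⟨fun x : S => f x, h⟩ else 0

/-- `X_n ⇝ Y` in `ℓ^∞(S)`: for all large `n` the trajectories of `X_n` are bounded on `S`, so are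
those of `Y`, and the restrictions to `S` converge weakly in `ℓ^∞(S)`. -/
def WeakConvLinf {d : ℕ} (S : Set (Fin d → ℝ)) (P : ∀ n, Measure (Ω n))
    (X : ∀ n, Ω n → (Fin d → ℝ) → ℝ) {Ω' : Type*} [MeasurableSpace Ω'] (Q : Measure Ω')
    (Y : Ω' → (Fin d → ℝ) → ℝ) : Prop :=
  (∀ᶠ n in atTop, ∀ ω, BddOnSet S (X n ω)) ∧ (∀ ω, BddOnSet S (Y ω)) ∧
    WeakConv P (fun n ω => toLinf S (X n ω)) Q (fun ω => toLinf S (Y ω))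

end Stochastic

end BetaStdf

end

/-!
Write `w = √k (lhat - l)`. At `x ∈ [0, 1]^d` the smoothing error is the average of `w y - w x` under
`ν_{n,k,x}` plus `√k` times the bias, the average of `l y - l x`.

Increments. Weak convergence to a continuous limit on a compact cube gives asymptotic
equicontinuity and boundedness of `w` on `[0, 1 + δ]^d`. By its second moments `ν_{n,k,x}`
concentrates around `x` at scale `1 / √k`, and by Chernoff's bound it charges the complement of the
larger cube by at most `d exp (-c k)`. There `w` is `O(n)`, and `log n = o(k)` makes `n exp (-c k)`
negligible.

Bias. A stable tail dependence function is Lipschitz, by the probability integral transform. In a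
coordinate-wise expansion of `l` around `x` the linear part integrates to zero, because `ν_{n,k,x}`
has mean `x`. The partial derivative in `x_j` may be discontinuous at `x_j = 0`, but close to that
face the fluctuations of `y_j` have size `√(x_j / k)`, so that the Lipschitz bound is enough.

The limit is then transferred from `lhat` to its smoothed version as in Slutsky's lemma: bounded
continuous test functions are approximated from above by Lipschitz ones, which are insensitive to
perturbations that are `o_P(1)` in supremum norm.
-/

noncomputable section

namespace BetaStdf

lemma exists_cdf_eq {μ : Measure ℝ} (hμ : Continuous (cdf μ)) {u : ℝ} (hu : u ∈ Set.Ioo 0 1) :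
    ∃ s, cdf μ s = u := by
  obtain ⟨a, ha⟩ := ((tendsto_cdf_atBot μ).eventually (gt_mem_nhds hu.1)).exists
  obtain ⟨b, hb⟩ := ((tendsto_cdf_atTop μ).eventually (lt_mem_nhds hu.2)).exists
  exact mem_range_of_exists_le_of_exists_ge hμ ⟨a, ha.le⟩ ⟨b, hb.le⟩

section ProbabilityIntegralTransform

variable {μ : Measure ℝ} [IsProbabilityMeasure μ] {u : ℝ}

lemma le_measureReal_cdf_le (hμ : Continuous (cdf μ)) (h0 : 0 ≤ u) (h1 : u < 1) :
    u ≤ μ.real {s | cdf μ s ≤ u} := by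
  rcases h0.eq_or_lt with rfl | h0
  · exact measureReal_nonneg
  obtain ⟨r, rfl⟩ := exists_cdf_eq hμ ⟨h0, h1⟩
  calc cdf μ r = μ.real (Set.Iic r) := cdf_eq_real μ r
    _ ≤ _ := measureReal_mono fun s hs => monotone_cdf μ hs

lemma measureReal_cdf_le_le (hμ : Continuous (cdf μ)) (h0 : 0 ≤ u) :
    μ.real {s | cdf μ s ≤ u} ≤ u := by
  refine le_of_forall_gt_imp_ge_of_dense fun v huv => ?_
  rcases lt_or_ge v 1 with hv | hv
  · obtain ⟨r, rfl⟩ := exists_cdf_eq hμ ⟨h0.trans_lt huv, hv⟩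
    rw [cdf_eq_real μ r]
    exact measureReal_mono fun s hs => ((monotone_cdf μ).reflect_lt (hs.trans_lt huv)).le
  · exact measureReal_le_one.trans hv

lemma measureReal_cdf_mem_Ioc_le (hμ : Continuous (cdf μ)) {a b : ℝ} (ha : 0 ≤ a) (hab : a ≤ b) :
    μ.real {s | cdf μ s ∈ Set.Ioc a b} ≤ b - a := by
  rcases lt_or_ge a 1 with ha1 | ha1
  · have hdiff : {s | cdf μ s ∈ Set.Ioc a b} = {s | cdf μ s ≤ b} \ {s | cdf μ s ≤ a} := by
      ext s
      simp [and_comm]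
    have hsub : {s | cdf μ s ≤ a} ⊆ {s | cdf μ s ≤ b} := fun s hs => le_trans hs hab
    rw [hdiff, measureReal_sdiff hsub
      (measurableSet_le (monotone_cdf μ).measurable measurable_const)]
    exact sub_le_sub (measureReal_cdf_le_le hμ (ha.trans hab)) (le_measureReal_cdf_le hμ ha ha1)
  · have hempty : {s | cdf μ s ∈ Set.Ioc a b} = ∅ :=
      Set.eq_empty_of_forall_notMem fun s hs => (cdf_le_one μ s).not_gt (ha1.trans_lt hs.1)
    rw [hempty, measureReal_empty]
    exact sub_nonneg.2 hab

lemma measureReal_map_cdf_mem_Ioc_le {A : Type*} [MeasurableSpace A] {P : Measure A}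
    [IsProbabilityMeasure P] {X : A → ℝ} (hX : Measurable X) (hc : Continuous (cdf (P.map X)))
    {a b : ℝ} (ha : 0 ≤ a) : P.real {ω | cdf (P.map X) (X ω) ∈ Set.Ioc a b} ≤ |b - a| := by
  have := Measure.isProbabilityMeasure_map (μ := P) hX.aemeasurable
  rcases le_or_gt a b with hab | hab
  · rw [abs_of_nonneg (sub_nonneg.2 hab)]
    refine le_trans (le_of_eq ?_) (measureReal_cdf_mem_Ioc_le hc ha hab)
    exact (map_measureReal_apply hX ((monotone_cdf _).measurable measurableSet_Ioc)).symm
  · simp [Set.Ioc_eq_empty hab.not_gt]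

end ProbabilityIntegralTransform

section Stdf

variable {d : ℕ} {l : (Fin d → ℝ) → ℝ}

lemma measureReal_exists_lt_le {A ι : Type*} [MeasurableSpace A] [Fintype ι] {P : Measure A}
    [IsFiniteMeasure P] (U : ι → A → ℝ) (a b : ι → ℝ) :
    P.real {ω | ∃ j, a j < U j ω} ≤
      P.real {ω | ∃ j, b j < U j ω} + ∑ j, P.real {ω | U j ω ∈ Set.Ioc (a j) (b j)} := by
  have hsub : {ω | ∃ j, a j < U j ω} ⊆
      {ω | ∃ j, b j < U j ω} ∪ ⋃ j, {ω | U j ω ∈ Set.Ioc (a j) (b j)} := by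
    rintro ω ⟨j, hj⟩
    rcases lt_or_ge (b j) (U j ω) with h | h
    · exact Or.inl ⟨j, h⟩
    · exact Or.inr (Set.mem_iUnion.2 ⟨j, hj, h⟩)
  calc P.real {ω | ∃ j, a j < U j ω} ≤ _ := measureReal_mono hsub
    _ ≤ _ := measureReal_union_le _ _
    _ ≤ _ := by gcongr; exact measureReal_iUnion_fintype_le _

lemma IsStdf.sub_le_sum_abs (hl : IsStdf d l) {x y : Fin d → ℝ} (hx : 0 ≤ x) (hy : 0 ≤ y) :
    l x - l y ≤ ∑ j, |x j - y j| := by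
  obtain ⟨F, hF, hc, hlim⟩ := hl
  refine le_of_tendsto ((hlim x hx).sub (hlim y hy)) ?_
  have hsmall : ∀ᶠ t : ℝ in 𝓝[>] 0, ∀ j, t * x j < 1 := by
    refine eventually_all.2 fun j => nhdsWithin_le_nhds ?_
    exact (continuous_mul_const (x j)).tendsto' 0 0 (zero_mul _) |>.eventually_lt_const one_pos
  filter_upwards [hsmall, self_mem_nhdsWithin] with t htx (ht : 0 < t)
  have hslab : ∀ j, F.real {X | cdf (F.map fun X => X j) (X j) ∈
      Set.Ioc (1 - t * x j) (1 - t * y j)} ≤ t * |x j - y j| := fun j => by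
    refine (measureReal_map_cdf_mem_Ioc_le (measurable_pi_apply j) (hc j)
      (sub_nonneg.2 (htx j).le)).trans_eq ?_
    rw [sub_sub_sub_cancel_left, ← mul_sub, abs_mul, abs_of_pos ht]
  have hunion := measureReal_exists_lt_le (P := F) (fun j X => cdf (F.map fun X => X j) (X j))
    (fun j => 1 - t * x j) (fun j => 1 - t * y j)
  rw [← mul_sub, inv_mul_le_iff₀ ht, sub_le_iff_le_add', Finset.mul_sum]
  exact hunion.trans (by gcongr with j; exact hslab j)

theorem IsStdf.lipschitzOnWith (hl : IsStdf d l) : LipschitzOnWith d l (Set.Ici 0) := by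
  refine LipschitzOnWith.of_le_add_mul _ fun x hx y hy => ?_
  have hsum : ∑ j, |x j - y j| ≤ d * dist x y := by
    simpa [← Real.dist_eq] using
      Finset.sum_le_card_nsmul Finset.univ _ (dist x y) fun j _ => dist_le_pi_dist x y j
  have := hl.sub_le_sum_abs hx hy
  rw [NNReal.coe_natCast]
  linarith

end Stdf

section Binomial

variable (n : ℕ) (p : unitInterval)

lemma integral_binomial_eq_sum_bernstein (f : ℕ → ℝ) :
    ∫ t, f t ∂binomial n p =
      ∑ i ∈ Finset.range (n + 1), f i * (bernsteinPolynomial ℝ n i).eval (p : ℝ) := by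
  rw [integral_binomial, Nat.range_succ_eq_Iic]
  refine Finset.sum_congr rfl fun i _ => ?_
  simp only [bernsteinPolynomial, smul_eq_mul, Polynomial.eval_mul, Polynomial.eval_natCast,
    Polynomial.eval_pow, Polynomial.eval_X, Polynomial.eval_sub, Polynomial.eval_one]
  ring

lemma integral_binomial_natCast : ∫ t, (t : ℝ) ∂binomial n p = n * p := by
  rw [integral_binomial_eq_sum_bernstein]
  have h := congrArg (Polynomial.eval (p : ℝ)) (bernsteinPolynomial.sum_smul ℝ n)
  simpa [Polynomial.eval_finsetSum] using h

lemma integral_binomial_sub_mean_sq :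
    ∫ t, ((t : ℝ) - n * p) ^ 2 ∂binomial n p = n * p * (1 - p) := by
  rw [integral_binomial_eq_sum_bernstein]
  have h := congrArg (Polynomial.eval (p : ℝ)) (bernsteinPolynomial.variance ℝ n)
  simp only [Polynomial.eval_finsetSum, Polynomial.eval_mul, Polynomial.eval_pow,
    Polynomial.eval_sub, Polynomial.eval_X, Polynomial.eval_natCast,
    Polynomial.eval_one, nsmul_eq_mul] at h
  rw [← h]
  exact Finset.sum_congr rfl fun i _ => by ring

lemma integral_binomial_exp_mul (s : ℝ) :
    ∫ t, Real.exp (s * t) ∂binomial n p = (p * Real.exp s + (1 - p)) ^ n := by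
  rw [integral_binomial, add_pow, Nat.range_succ_eq_Iic]
  refine Finset.sum_congr rfl fun i _ => ?_
  rw [mul_comm s, Real.exp_nat_mul, mul_pow, smul_eq_mul]
  ring

lemma integral_binomial_exp_mul_le (s : ℝ) :
    ∫ t, Real.exp (s * t) ∂binomial n p ≤ Real.exp (n * p * (Real.exp s - 1)) := by
  have hp := p.2
  have hbase : p * Real.exp s + (1 - p) ≤ Real.exp (p * (Real.exp s - 1)) := by
    linarith [Real.add_one_le_exp (p * (Real.exp s - 1))]
  rw [integral_binomial_exp_mul, mul_assoc, Real.exp_nat_mul]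
  exact pow_le_pow_left₀ (add_nonneg (mul_nonneg hp.1 (Real.exp_pos s).le)
    (sub_nonneg.2 hp.2)) hbase n

lemma ae_binomial_le : ∀ᵐ t ∂binomial n p, t ≤ n := ae_le_of_hasLaw_binomial (X := id) HasLaw.id

end Binomial

lemma integrable_of_ae_mem_finite {A E : Type*} [MeasurableSpace A] [MeasurableSingletonClass A]
    [NormedAddCommGroup E] {μ : Measure A} [IsFiniteMeasure μ] {S : Set A} (hS : S.Finite)
    (h : ∀ᵐ y ∂μ, y ∈ S) (f : A → E) : Integrable f μ := by
  rw [← Measure.restrict_eq_self_of_ae_mem h]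
  exact IntegrableOn.of_finite hS

lemma cube_subset_cube (d : ℕ) {M N : ℝ} (h : M ≤ N) : cube d M ⊆ cube d N :=
  Set.Icc_subset_Icc le_rfl fun _ => h

lemma dist_sq_le_sum_sub_sq {ι : Type*} [Fintype ι] (x y : ι → ℝ) :
    dist x y ^ 2 ≤ ∑ j, (y j - x j) ^ 2 := by
  refine (Real.le_sqrt dist_nonneg (Finset.sum_nonneg fun j _ => sq_nonneg _)).1 ?_
  refine (dist_pi_le_iff (Real.sqrt_nonneg _)).2 fun j => ?_
  rw [dist_comm, Real.dist_eq]
  exact Real.abs_le_sqrt (Finset.single_le_sum (f := fun j => (y j - x j) ^ 2)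
    (fun j _ => sq_nonneg _) (Finset.mem_univ j))

section BetaSmoother

variable {d n : ℕ} {k : ℝ} {x : Fin d → ℝ}

/-- The success probability `(k / n) s` of the binomial laws behind `betaSmoother`, as an element of
the unit interval. Values outside `[0, 1]`, which do not occur for `s ∈ [0, n / k]`, are
projected. -/
def successProb (n : ℕ) (k s : ℝ) : unitInterval := Set.projIcc 0 1 zero_le_one (k / n * s)

lemma natCast_mul_successProb (hk : 0 < k) {s : ℝ} (hs : s ∈ Set.Icc 0 ((n : ℝ) / k)) :
    n * (successProb n k s : ℝ) = k * s := by
  have hks : k * s ≤ n := (le_div_iff₀' hk).1 hs.2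
  rcases n.eq_zero_or_pos with rfl | hn
  · have hs0 : s = 0 := le_antisymm (by simpa using hs.2) hs.1
    simp [hs0]
  · have hn : (0 : ℝ) < n := Nat.cast_pos.2 hn
    have hmem : k / n * s ∈ Set.Icc (0 : ℝ) 1 := by
      rw [div_mul_eq_mul_div]
      exact ⟨div_nonneg (mul_nonneg hk.le hs.1) hn.le, (div_le_one hn).2 hks⟩
    rw [successProb, Set.projIcc_of_mem _ hmem]
    field_simp

instance isProbabilityMeasure_betaSmoother : IsProbabilityMeasure (betaSmoother n k x) := by
  have (j : Fin d) : IsProbabilityMeasure ((binomial n (Set.projIcc (0 : ℝ) 1 zero_le_one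
      (k / n * x j))).map fun t : ℕ => (t : ℝ) / k) :=
    Measure.isProbabilityMeasure_map (by fun_prop)
  unfold betaSmoother
  infer_instance

lemma measurePreserving_eval_betaSmoother (j : Fin d) :
    MeasurePreserving (fun y : Fin d → ℝ => y j) (betaSmoother n k x)
      ((binomial n (successProb n k (x j))).map fun t : ℕ => (t : ℝ) / k) := by
  have (i : Fin d) : IsProbabilityMeasure ((binomial n (Set.projIcc (0 : ℝ) 1 zero_le_one
      (k / n * x i))).map fun t : ℕ => (t : ℝ) / k) :=
    Measure.isProbabilityMeasure_map (by fun_prop)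
  exact measurePreserving_eval _ j

/-- The finite grid `{0, 1 / k, …, n / k}^d`, which carries `betaSmoother n k x`. -/
def grid (d n : ℕ) (k : ℝ) : Set (Fin d → ℝ) :=
  Set.univ.pi fun _ => (fun t : ℕ => (t : ℝ) / k) '' Set.Iic n

lemma finite_grid (d n : ℕ) (k : ℝ) : (grid d n k).Finite :=
  Set.Finite.pi fun _ => (Set.finite_Iic n).image _

lemma grid_subset_cube (hk : 0 < k) : grid d n k ⊆ cube d (n / k) := by
  intro y hy
  simp only [grid, Set.mem_univ_pi] at hy
  refine ⟨fun j => ?_, fun j => ?_⟩ <;> obtain ⟨t, ht, hy⟩ := hy j <;> rw [← hy]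
  · exact div_nonneg t.cast_nonneg hk.le
  · exact div_le_div_of_nonneg_right (Nat.cast_le.2 ht) hk.le

lemma ae_betaSmoother_mem_grid : ∀ᵐ y ∂betaSmoother n k x, y ∈ grid d n k := by
  simp only [grid, Set.mem_univ_pi]
  refine ae_all_iff.2 fun j => (measurePreserving_eval_betaSmoother j).quasiMeasurePreserving.ae
    (p := fun s => s ∈ (fun t : ℕ => (t : ℝ) / k) '' Set.Iic n) ?_
  refine (ae_map_iff (by fun_prop) ((Set.finite_Iic n).image _).measurableSet).2 ?_
  filter_upwards [ae_binomial_le n _] with t ht using ⟨t, ht, rfl⟩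

lemma ae_betaSmoother_mem_cube (hk : 0 < k) : ∀ᵐ y ∂betaSmoother n k x, y ∈ cube d (n / k) :=
  ae_betaSmoother_mem_grid.mono fun _ hy => grid_subset_cube hk hy

lemma integrable_betaSmoother (f : (Fin d → ℝ) → ℝ) : Integrable f (betaSmoother n k x) :=
  integrable_of_ae_mem_finite (finite_grid d n k) ae_betaSmoother_mem_grid f

lemma betaSmooth_eq_integral (hk : 0 < k) (g : (Fin d → ℝ) → ℝ) :
    betaSmooth n k g x = ∫ y, g y ∂betaSmoother n k x := by
  rw [betaSmooth, Measure.restrict_eq_self_of_ae_mem (ae_betaSmoother_mem_cube hk)]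

lemma integral_betaSmoother_comp_eval (j : Fin d) {f : ℝ → ℝ} (hf : Measurable f) :
    ∫ y, f (y j) ∂betaSmoother n k x = ∫ t, f (t / k) ∂binomial n (successProb n k (x j)) := by
  have h := measurePreserving_eval_betaSmoother (n := n) (k := k) (x := x) j
  rw [← integral_map (f := f) h.measurable.aemeasurable hf.aestronglyMeasurable, h.map_eq,
    integral_map (by fun_prop) hf.aestronglyMeasurable]

lemma integral_betaSmoother_eval (hk : 0 < k) (hx : x ∈ cube d (n / k)) (j : Fin d) :
    ∫ y, y j ∂betaSmoother n k x = x j := by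
  rw [integral_betaSmoother_comp_eval j (f := fun s => s) measurable_id, integral_div,
    integral_binomial_natCast, natCast_mul_successProb hk ⟨hx.1 j, hx.2 j⟩,
    mul_div_cancel_left₀ _ hk.ne']

lemma integral_betaSmoother_sub_sq_le (hk : 0 < k) (hx : x ∈ cube d (n / k)) (j : Fin d) :
    ∫ y, (y j - x j) ^ 2 ∂betaSmoother n k x ≤ x j / k := by
  set p := successProb n k (x j)
  have hmean : n * (p : ℝ) = k * x j := natCast_mul_successProb hk ⟨hx.1 j, hx.2 j⟩
  have hscale (t : ℕ) : ((t : ℝ) / k - x j) ^ 2 = (t - n * p) ^ 2 / k ^ 2 := by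
    rw [hmean]
    field_simp
  have hx0 : 0 ≤ x j := hx.1 j
  calc ∫ y, (y j - x j) ^ 2 ∂betaSmoother n k x
      = n * p * (1 - p) / k ^ 2 := by
        rw [integral_betaSmoother_comp_eval j (f := fun s => (s - x j) ^ 2) (by fun_prop)]
        simp only [hscale]
        rw [integral_div, integral_binomial_sub_mean_sq]
    _ ≤ k * x j * 1 / k ^ 2 := by
        rw [hmean]
        gcongr
        exact sub_le_self 1 p.2.1
    _ = x j / k := by field_simp

lemma integral_betaSmoother_abs_sub_le (hk : 0 < k) (hx : x ∈ cube d (n / k)) (j : Fin d) :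
    ∫ y, |y j - x j| ∂betaSmoother n k x ≤ √(x j / k) := by
  refine Real.le_sqrt_of_sq_le (le_trans ?_ (integral_betaSmoother_sub_sq_le hk hx j))
  have hjensen := ConvexOn.map_integral_le (μ := betaSmoother n k x) (s := Set.univ)
    (g := fun s : ℝ => s ^ 2) (f := fun y => |y j - x j|) (Even.convexOn_pow even_two)
    (by fun_prop) isClosed_univ (by simp) (integrable_betaSmoother _) (integrable_betaSmoother _)
  simpa only [sq_abs, Function.comp_def] using hjensen

lemma integral_betaSmoother_dist_sq_le (hk : 0 < k) (hx : x ∈ cube d (n / k)) :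
    ∫ y, dist x y ^ 2 ∂betaSmoother n k x ≤ (∑ j, x j) / k := by
  calc ∫ y, dist x y ^ 2 ∂betaSmoother n k x
      ≤ ∫ y, ∑ j, (y j - x j) ^ 2 ∂betaSmoother n k x :=
        integral_mono (integrable_betaSmoother _) (integrable_betaSmoother _)
          fun y => dist_sq_le_sum_sub_sq x y
    _ = ∑ j, ∫ y, (y j - x j) ^ 2 ∂betaSmoother n k x :=
        integral_finsetSum _ fun _ _ => integrable_betaSmoother _
    _ ≤ ∑ j, x j / k := Finset.sum_le_sum fun j _ => integral_betaSmoother_sub_sq_le hk hx j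
    _ = (∑ j, x j) / k := (Finset.sum_div _ _ _).symm

/-- The rate in Chernoff's bound `P (Z ≥ (1 + δ) m) ≤ exp (-chernoffRate δ * m)` for a binomial
variable `Z` of mean `m`. -/
def chernoffRate (δ : ℝ) : ℝ := (1 + δ) * Real.log (1 + δ) - δ

lemma chernoffRate_pos {δ : ℝ} (hδ : 0 < δ) : 0 < chernoffRate δ := by
  have h1 : 0 < 1 + δ := by linarith
  have hlog := Real.log_lt_sub_one_of_pos (inv_pos.2 h1) (inv_lt_one_of_one_lt₀ (by linarith)).ne
  rw [Real.log_inv] at hlog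
  have hmul := mul_lt_mul_of_pos_left hlog h1
  rw [mul_sub, mul_inv_cancel₀ h1.ne'] at hmul
  rw [chernoffRate]
  linarith

lemma measureReal_betaSmoother_one_add_le_le (hk : 0 < k) (hx : x ∈ cube d (n / k)) {j : Fin d}
    (hx1 : x j ≤ 1) {δ : ℝ} (hδ : 0 ≤ δ) :
    (betaSmoother n k x).real {y | 1 + δ ≤ y j} ≤ Real.exp (-chernoffRate δ * k) := by
  have hexp : Real.exp (Real.log (1 + δ)) = 1 + δ := Real.exp_log (by linarith)
  set s := Real.log (1 + δ) with hs
  have hs0 : 0 ≤ s := Real.log_nonneg (by linarith)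
  have hmgf : mgf (fun y => y j) (betaSmoother n k x) (s * k) ≤ Real.exp (k * δ) := by
    rw [mgf, integral_betaSmoother_comp_eval j (f := fun r => Real.exp (s * k * r)) (by fun_prop)]
    have hcancel (t : ℕ) : s * k * (t / k) = s * t := by field_simp
    simp only [hcancel]
    refine (integral_binomial_exp_mul_le n _ s).trans (Real.exp_le_exp.2 ?_)
    rw [natCast_mul_successProb hk ⟨hx.1 j, hx.2 j⟩, hexp, add_sub_cancel_left]
    exact mul_le_mul_of_nonneg_right (mul_le_of_le_one_right hk.le hx1) hδ
  calc (betaSmoother n k x).real {y | 1 + δ ≤ y j}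
      ≤ Real.exp (-(s * k) * (1 + δ)) * mgf (fun y => y j) (betaSmoother n k x) (s * k) :=
        measure_ge_le_exp_mul_mgf _ (by positivity) (integrable_betaSmoother _)
    _ ≤ Real.exp (-(s * k) * (1 + δ)) * Real.exp (k * δ) := by gcongr
    _ = Real.exp (-chernoffRate δ * k) := by
        rw [← Real.exp_add, chernoffRate, ← hs]
        ring_nf

lemma measureReal_betaSmoother_compl_cube_le (hk : 0 < k) (hkn : k ≤ n) (hx : x ∈ cube d 1)
    {δ : ℝ} (hδ : 0 ≤ δ) :
    (betaSmoother n k x).real (cube d (1 + δ))ᶜ ≤ d * Real.exp (-chernoffRate δ * k) := by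
  have hx' : x ∈ cube d (n / k) := cube_subset_cube d ((one_le_div hk).2 hkn) hx
  have hsub : (cube d (1 + δ))ᶜ ≤ᵐ[betaSmoother n k x] (⋃ j, {y | 1 + δ ≤ y j} : Set _) := by
    filter_upwards [ae_betaSmoother_mem_cube hk] with y hy hy'
    by_contra hcon
    refine hy' ⟨hy.1, fun j => ?_⟩
    by_contra h
    exact hcon (Set.mem_iUnion.2 ⟨j, (not_le.1 h).le⟩)
  calc (betaSmoother n k x).real (cube d (1 + δ))ᶜ
      ≤ (betaSmoother n k x).real (⋃ j, {y | 1 + δ ≤ y j}) :=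
        ENNReal.toReal_mono (measure_ne_top _ _) (measure_mono_ae hsub)
    _ ≤ ∑ j, (betaSmoother n k x).real {y | 1 + δ ≤ y j} := measureReal_iUnion_fintype_le _
    _ ≤ ∑ _j : Fin d, Real.exp (-chernoffRate δ * k) := Finset.sum_le_sum fun j _ =>
        measureReal_betaSmoother_one_add_le_le hk hx' (hx.2 j) hδ
    _ = d * Real.exp (-chernoffRate δ * k) := by simp

end BetaSmoother

section PartialDerivatives

lemma exists_forall_dist_lt_of_continuousOn {X Y : Type*} [PseudoMetricSpace X]
    [PseudoMetricSpace Y] {f : X → Y} {S T : Set X} (hT : IsCompact T) (hTS : T ⊆ S)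
    (hf : ContinuousOn f S) {ε : ℝ} (hε : 0 < ε) :
    ∃ η > 0, ∀ x ∈ T, ∀ z ∈ S, dist x z < η → dist (f x) (f z) < ε := by
  have hT' : IsCompact ((↑) ⁻¹' T : Set S) := by
    rw [Subtype.isCompact_iff, Subtype.image_preimage_coe, Set.inter_eq_right.2 hTS]
    exact hT
  obtain ⟨η, hη, h⟩ := Metric.mem_uniformity_dist.1 <|
    hT'.uniformContinuousAt_of_continuousAt (S.domRestrict f)
      (fun x _ => hf.domRestrict.continuousAt) (Metric.dist_mem_uniformity hε)
  exact ⟨η, hη, fun x hx z hz hxz => h (a := ⟨x, hTS hx⟩) (b := ⟨z, hz⟩) hxz hx⟩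

section Telescoping

variable {ι : Type*} [Fintype ι] {X : ι → Type*}

lemma norm_sub_sub_sum_le_of_update [DecidableEq ι] {E : Type*} [SeminormedAddCommGroup E]
    {f : (∀ i, X i) → E} {x y : ∀ i, X i} {c : ι → E} {b : ι → ℝ}
    (h : ∀ j w, (∀ i, w i = x i ∨ w i = y i) → w j = y j →
      ‖f w - f (Function.update w j (x j)) - c j‖ ≤ b j) :
    ‖f y - f x - ∑ j, c j‖ ≤ ∑ j, b j := by
  suffices ∀ s : Finset ι, ‖f (s.piecewise y x) - f x - ∑ j ∈ s, c j‖ ≤ ∑ j ∈ s, b j by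
    simpa only [Finset.piecewise_univ] using this Finset.univ
  intro s
  induction s using Finset.induction_on with
  | empty => simp
  | insert j s hj ih =>
    have hmem (i : ι) : (insert j s).piecewise y x i = x i ∨
        (insert j s).piecewise y x i = y i := by
      by_cases hi : i ∈ insert j s <;> simp only [Finset.piecewise, hi, if_true, if_false, true_or,
        or_true]
    have hstep := h j _ hmem (Finset.piecewise_insert_self (j := j) (s := s) y x)
    have hback : Function.update (s.piecewise y x) j (x j) = s.piecewise y x := by
      rw [← Finset.piecewise_eq_of_notMem s y x hj, Function.update_eq_self]
    rw [Finset.piecewise_insert, Function.update_idem, hback] at hstep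
    rw [Finset.sum_insert hj, Finset.sum_insert hj, Finset.piecewise_insert]
    refine le_trans (le_of_eq ?_) ((norm_add_le _ _).trans (add_le_add hstep ih))
    congr 1
    abel

variable [∀ i, PseudoMetricSpace (X i)]

lemma dist_le_dist_of_eq_or_eq {x y w : ∀ i, X i} (hw : ∀ i, w i = x i ∨ w i = y i) :
    dist x w ≤ dist x y := by
  refine (dist_pi_le_iff dist_nonneg).2 fun i => ?_
  rcases hw i with h | h <;> rw [h]
  · rw [dist_self]
    exact dist_nonneg
  · exact dist_le_pi_dist x y i

lemma dist_update_update_le [DecidableEq ι] (w : ∀ i, X i) (j : ι) (s t : X j) :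
    dist (Function.update w j s) (Function.update w j t) ≤ dist s t := by
  refine (dist_pi_le_iff dist_nonneg).2 fun i => ?_
  rcases eq_or_ne i j with rfl | h
  · simp only [Function.update_self, le_refl]
  · simp only [Function.update_of_ne h, dist_self, dist_nonneg]

end Telescoping

variable {ι : Type*} [DecidableEq ι] {f f' : (ι → ℝ) → ℝ} {j : ι}

lemma update_nonneg {w : ι → ℝ} (hw : 0 ≤ w) {s : ℝ} (hs : 0 ≤ s) :
    0 ≤ Function.update w j s :=
  Pi.le_def.2 <| (Function.forall_update_iff w fun _ r => 0 ≤ r).2 ⟨hs, fun i _ => hw i⟩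

lemma abs_sub_update_sub_mul_le {w : ι → ℝ} {t a ε : ℝ}
    (hder : ∀ s ∈ Set.uIcc t (w j),
      HasDerivAt (fun r => f (Function.update w j r)) (f' (Function.update w j s)) s)
    (hε : ∀ s ∈ Set.uIcc t (w j), |f' (Function.update w j s) - a| ≤ ε) :
    |f w - f (Function.update w j t) - a * (w j - t)| ≤ ε * |w j - t| := by
  have hder' (s : ℝ) (hs : s ∈ Set.uIcc t (w j)) :
      HasDerivWithinAt (fun r => f (Function.update w j r) - r * a)
        (f' (Function.update w j s) - a) (Set.uIcc t (w j)) s :=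
    ((hder s hs).sub (hasDerivAt_mul_const a)).hasDerivWithinAt
  have hmvt := Convex.norm_image_sub_le_of_norm_hasDerivWithin_le hder' hε (convex_uIcc _ _)
    Set.left_mem_uIcc Set.right_mem_uIcc
  rw [Function.update_eq_self, Real.norm_eq_abs, Real.norm_eq_abs] at hmvt
  convert hmvt using 2
  ring

variable [Fintype ι]

lemma dist_update_le_of_mem_uIcc {x w : ι → ℝ} {s : ℝ} (hs : s ∈ Set.uIcc (x j) (w j)) :
    dist x (Function.update w j s) ≤ dist x w := by
  refine (dist_pi_le_iff dist_nonneg).2 fun i => ?_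
  rcases eq_or_ne i j with rfl | h
  · rw [Function.update_self, dist_comm, Real.dist_eq]
    refine (Set.abs_sub_left_of_mem_uIcc hs).trans ?_
    rw [← Real.dist_eq, dist_comm]
    exact dist_le_pi_dist x w i
  · rw [Function.update_of_ne h]
    exact dist_le_pi_dist x w i

variable {K : ℝ≥0}

lemma lipschitzOnWith_update (hf : LipschitzOnWith K f (Set.Ici 0)) {x : ι → ℝ} (hx : 0 ≤ x) :
    LipschitzOnWith K (fun s => f (Function.update x j s)) (Set.Ici 0) := by
  refine LipschitzOnWith.of_dist_le_mul fun s hs t ht => ?_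
  refine (hf.dist_le_mul _ (update_nonneg hx hs) _ (update_nonneg hx ht)).trans ?_
  gcongr
  exact dist_update_update_le x j s t

lemma abs_sub_update_le (hf : LipschitzOnWith K f (Set.Ici 0)) {w : ι → ℝ} (hw : 0 ≤ w) {t : ℝ}
    (ht : 0 ≤ t) : |f w - f (Function.update w j t)| ≤ K * |w j - t| := by
  have h := (lipschitzOnWith_update (j := j) hf hw).dist_le_mul (w j) (hw j) t ht
  rwa [Function.update_eq_self, Real.dist_eq, Real.dist_eq] at h

lemma abs_sub_update_sub_mul_le_of_le_dist (hf : LipschitzOnWith K f (Set.Ici 0)) {x w : ι → ℝ}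
    (hxj : 0 ≤ x j) (hw : 0 ≤ w) {a ρ : ℝ} (ha : |a| ≤ K) (hρ : 0 < ρ) (hfar : ρ ≤ dist x w) :
    |f w - f (Function.update w j (x j)) - a * (w j - x j)| ≤ 2 * K / ρ * dist x w ^ 2 := by
  have hcoord : |w j - x j| ≤ dist x w := by
    rw [← Real.dist_eq, dist_comm]
    exact dist_le_pi_dist x w j
  calc |f w - f (Function.update w j (x j)) - a * (w j - x j)|
      ≤ K * |w j - x j| + K * |w j - x j| := by
        refine (abs_sub _ _).trans (add_le_add (abs_sub_update_le hf hw hxj) ?_)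
        rw [abs_mul]
        gcongr
    _ ≤ 2 * K * dist x w * (dist x w / ρ) := by
        rw [← two_mul, ← mul_assoc]
        exact (mul_le_mul_of_nonneg_left hcoord (by positivity)).trans
          (le_mul_of_one_le_right (by positivity) ((one_le_div hρ).2 hfar))
    _ = 2 * K / ρ * dist x w ^ 2 := by ring

end PartialDerivatives

section Bias

variable {d : ℕ} {l l' : (Fin d → ℝ) → ℝ} {K : ℝ≥0} {j : Fin d} {ε : ℝ}

-- For `w` close to `x` this is the mean value theorem; for the others, the Lipschitz bound is
-- absorbed by the quadratic term.
lemma exists_partial_expansion_of_le (hl : LipschitzOnWith K l (Set.Ici 0))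
    (hcont : ContinuousOn l' {x | 0 ≤ x ∧ 0 < x j})
    (hder : ∀ x, 0 ≤ x → 0 < x j → HasDerivAt (fun s => l (Function.update x j s)) (l' x) (x j))
    (hε : 0 < ε) {τ : ℝ} (hτ : 0 < τ) :
    ∃ C, 0 ≤ C ∧ ∀ x ∈ cube d 1, τ ≤ x j → ∀ w, 0 ≤ w →
      |l w - l (Function.update w j (x j)) - l' x * (w j - x j)| ≤
        ε * |w j - x j| + C * dist x w ^ 2 := by
  have hcompact : IsCompact {x : Fin d → ℝ | x ∈ cube d 1 ∧ τ ≤ x j} :=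
    isCompact_Icc.inter_right (isClosed_le continuous_const (continuous_apply j))
  have hsub : {x : Fin d → ℝ | x ∈ cube d 1 ∧ τ ≤ x j} ⊆ {x | 0 ≤ x ∧ 0 < x j} :=
    fun x hx => ⟨hx.1.1, hτ.trans_le hx.2⟩
  obtain ⟨η, hη, hunif⟩ := exists_forall_dist_lt_of_continuousOn hcompact hsub hcont hε
  have hρ : 0 < min η τ := lt_min hη hτ
  refine ⟨2 * K / min η τ, by positivity, fun x hx hxj w hw => ?_⟩
  rcases lt_or_ge (dist x w) (min η τ) with hnear | hfar
  · obtain ⟨hnearη, hnearτ⟩ := lt_min_iff.1 hnear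
    have hmem (s : ℝ) (hs : s ∈ Set.uIcc (x j) (w j)) :
        Function.update w j s ∈ {x | 0 ≤ x ∧ 0 < x j} := by
      have h := (dist_le_pi_dist x _ j).trans_lt ((dist_update_le_of_mem_uIcc hs).trans_lt hnearτ)
      rw [Function.update_self, Real.dist_eq] at h
      have hs0 : 0 < s := by linarith [(abs_lt.1 h).2]
      exact ⟨update_nonneg hw hs0.le, by rwa [Function.update_self]⟩
    refine (abs_sub_update_sub_mul_le (f' := l') (fun s hs => ?_) fun s hs => ?_).trans
      (le_add_of_nonneg_right (by positivity))
    · have h := hder _ (hmem s hs).1 (hmem s hs).2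
      simpa only [Function.update_idem, Function.update_self] using h
    · rw [← Real.dist_eq, dist_comm]
      exact (hunif x ⟨hx, hxj⟩ _ (hmem s hs)
        ((dist_update_le_of_mem_uIcc hs).trans_lt hnearη)).le
  · have hxj0 : 0 < x j := hτ.trans_le hxj
    have hderiv : |l' x| ≤ K := (hder x hx.1 hxj0).le_of_lipschitzOn
      (Ici_mem_nhds hxj0) (lipschitzOnWith_update hl hx.1)
    exact (abs_sub_update_sub_mul_le_of_le_dist hl hxj0.le hw hderiv hρ hfar).trans
      (le_add_of_nonneg_left (by positivity))

-- The weight `√(x j)` is the size of the fluctuations of `w j` under the beta smoother, up to a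
-- factor `√k`. Near the face `x j = 0`, where the partial derivative may be discontinuous, it makes
-- the crude Lipschitz bound `b = K` affordable.
lemma exists_partial_expansion (hl : LipschitzOnWith K l (Set.Ici 0))
    (hcont : ContinuousOn l' {x | 0 ≤ x ∧ 0 < x j})
    (hder : ∀ x, 0 ≤ x → 0 < x j → HasDerivAt (fun s => l (Function.update x j s)) (l' x) (x j))
    (hε : 0 < ε) :
    ∃ C, 0 ≤ C ∧ ∀ x ∈ cube d 1, ∃ a b, 0 ≤ b ∧ b * √(x j) ≤ ε ∧ ∀ w, 0 ≤ w →
      |l w - l (Function.update w j (x j)) - a * (w j - x j)| ≤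
        b * |w j - x j| + C * dist x w ^ 2 := by
  obtain ⟨C, hC, hexp⟩ := exists_partial_expansion_of_le hl hcont hder hε
    (τ := (ε / (K + 1)) ^ 2) (by positivity)
  refine ⟨C, hC, fun x hx => ?_⟩
  rcases lt_or_ge (x j) ((ε / (K + 1)) ^ 2) with hxj | hxj
  · refine ⟨0, K, K.coe_nonneg, ?_, fun w hw => ?_⟩
    · calc K * √(x j) ≤ (K + 1) * (ε / (K + 1)) := by
            gcongr
            · exact le_add_of_nonneg_right zero_le_one
            · exact Real.sqrt_le_iff.2 ⟨by positivity, hxj.le⟩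
        _ = ε := mul_div_cancel₀ _ (by positivity)
    · rw [zero_mul, sub_zero]
      exact (abs_sub_update_le hl hw (hx.1 j)).trans (le_add_of_nonneg_right (by positivity))
  · exact ⟨l' x, ε, hε.le, mul_le_of_le_one_right hε.le (Real.sqrt_le_one.2 (hx.2 j)),
      hexp x hx hxj⟩

lemma exists_expansion (hl : LipschitzOnWith K l (Set.Ici 0)) (hs : HasContPartials d l)
    (hε : 0 < ε) :
    ∃ C, 0 ≤ C ∧ ∀ x ∈ cube d 1, ∃ a b : Fin d → ℝ, (∀ j, 0 ≤ b j) ∧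
      (∀ j, b j * √(x j) ≤ ε) ∧ ∀ y, 0 ≤ y →
      |l y - l x - ∑ j, a j * (y j - x j)| ≤ ∑ j, b j * |y j - x j| + C * dist x y ^ 2 := by
  choose l' hcont hder using hs
  choose C hC hexp using fun j => exists_partial_expansion hl (hcont j) (hder j) hε
  refine ⟨∑ j, C j, Finset.sum_nonneg fun j _ => hC j, fun x hx => ?_⟩
  choose a b hb hbx hab using fun j => hexp j x hx
  refine ⟨a, b, hb, hbx, fun y hy => ?_⟩
  rw [Finset.sum_mul, ← Finset.sum_add_distrib, ← Real.norm_eq_abs]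
  refine norm_sub_sub_sum_le_of_update fun j w hw hwj => ?_
  have hw0 : 0 ≤ w := fun i => by
    rcases hw i with h | h <;> rw [h]
    exacts [hx.1 i, hy i]
  rw [← hwj]
  refine (hab j w hw0).trans ?_
  gcongr
  · exact hC j
  · exact dist_le_dist_of_eq_or_eq hw

-- Integrating the expansion against the smoother kills its linear term.
lemma abs_bias_le_of_expansion {n : ℕ} {k C : ℝ} {x a b : Fin d → ℝ} (hk : 0 < k)
    (hx : x ∈ cube d (n / k)) (hC : 0 ≤ C) (hb : ∀ j, 0 ≤ b j)
    (hexp : ∀ y, 0 ≤ y →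
      |l y - l x - ∑ j, a j * (y j - x j)| ≤ ∑ j, b j * |y j - x j| + C * dist x y ^ 2) :
    |∫ y, (l y - l x) ∂betaSmoother n k x| ≤
      ∑ j, b j * √(x j / k) + C * ((∑ j, x j) / k) := by
  set μ := betaSmoother n k x
  have hint (f : (Fin d → ℝ) → ℝ) : Integrable f μ := integrable_betaSmoother f
  have hlin : ∫ y, ∑ j, a j * (y j - x j) ∂μ = 0 := by
    rw [integral_finsetSum _ fun j _ => hint _]
    refine Finset.sum_eq_zero fun j _ => ?_
    rw [integral_const_mul, integral_sub (hint _) (hint _), integral_betaSmoother_eval hk hx j,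
      integral_const, probReal_univ, one_smul, sub_self, mul_zero]
  calc |∫ y, (l y - l x) ∂μ| = |∫ y, (l y - l x - ∑ j, a j * (y j - x j)) ∂μ| := by
        rw [integral_sub (hint fun y => l y - l x) (hint _), hlin, sub_zero]
    _ ≤ ∫ y, |l y - l x - ∑ j, a j * (y j - x j)| ∂μ := abs_integral_le_integral_abs
    _ ≤ ∫ y, (∑ j, b j * |y j - x j| + C * dist x y ^ 2) ∂μ :=
        integral_mono_ae (hint _) (hint _)
          ((ae_betaSmoother_mem_cube hk).mono fun y hy => hexp y hy.1)
    _ = ∑ j, b j * ∫ y, |y j - x j| ∂μ + C * ∫ y, dist x y ^ 2 ∂μ := by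
        rw [integral_add (hint _) (hint _), integral_finsetSum _ fun j _ => hint _]
        simp only [integral_const_mul]
    _ ≤ _ := by
        gcongr with j
        · exact hb j
        · exact integral_betaSmoother_abs_sub_le hk hx j
        · exact integral_betaSmoother_dist_sq_le hk hx

lemma exists_sqrt_mul_bias_le (hl : LipschitzOnWith K l (Set.Ici 0)) (hs : HasContPartials d l)
    (hε : 0 < ε) :
    ∃ C, ∀ (n : ℕ) (k : ℝ), 0 < k → k ≤ n → ∀ x ∈ cube d 1,
      √k * |∫ y, (l y - l x) ∂betaSmoother n k x| ≤ ε + C / √k := by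
  obtain ⟨C, hC, hexp⟩ := exists_expansion hl hs (ε := ε / (d + 1)) (by positivity)
  refine ⟨C * d, fun n k hk hkn x hx => ?_⟩
  obtain ⟨a, b, hb, hbx, hab⟩ := hexp x hx
  have hx' : x ∈ cube d (n / k) := cube_subset_cube d ((one_le_div hk).2 hkn) hx
  have hfluct (j : Fin d) : √k * (b j * √(x j / k)) ≤ ε / (d + 1) := by
    rw [mul_left_comm, ← Real.sqrt_mul hk.le, mul_div_cancel₀ _ hk.ne']
    exact hbx j
  have hsum : ∑ j, x j ≤ d := by
    simpa using Finset.sum_le_card_nsmul Finset.univ x 1 fun j _ => hx.2 j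
  calc √k * |∫ y, (l y - l x) ∂betaSmoother n k x|
      ≤ √k * (∑ j, b j * √(x j / k) + C * ((∑ j, x j) / k)) := by
        gcongr
        exact abs_bias_le_of_expansion hk hx' hC hb hab
    _ = ∑ j, √k * (b j * √(x j / k)) + C * (∑ j, x j) / √k := by
        rw [mul_add, Finset.mul_sum, mul_left_comm, mul_div_left_comm, Real.sqrt_div_self',
          mul_one_div, mul_div_assoc]
    _ ≤ ∑ _j : Fin d, ε / (d + 1) + C * d / √k := by
        gcongr with j
        exact hfluct j
    _ ≤ ε + C * d / √k := by
        gcongr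
        rw [Finset.sum_const, Finset.card_univ, Fintype.card_fin, nsmul_eq_mul, mul_div_left_comm]
        exact mul_le_of_le_one_right hε.le ((div_le_one (by positivity)).2 (by linarith))

end Bias

section OuterExpectation

variable {A : Type*} [MeasurableSpace A] {P : Measure A} {f g : A → ℝ}

lemma le_outerExp [IsFiniteMeasure P] {C r : ℝ} (hf : ∀ ω, f ω ≤ C)
    (h : ∀ U : A → ℝ, Measurable U → Integrable U P → (∀ ω, f ω ≤ U ω) → r ≤ ∫ ω, U ω ∂P) :
    r ≤ outerExp P f := by
  refine le_csInf ⟨_, fun _ => C, measurable_const, integrable_const C, hf, rfl⟩ ?_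
  rintro _ ⟨U, hU, hUi, hfU, rfl⟩
  exact h U hU hUi hfU

variable [IsFiniteMeasure P] {c C : ℝ}

lemma outerExp_le_integral (hf : ∀ ω, c ≤ f ω) {U : A → ℝ} (hU : Measurable U)
    (hUi : Integrable U P) (hfU : ∀ ω, f ω ≤ U ω) : outerExp P f ≤ ∫ ω, U ω ∂P := by
  refine csInf_le ⟨∫ _, c ∂P, ?_⟩ ⟨U, hU, hUi, hfU, rfl⟩
  rintro _ ⟨V, -, hVi, hfV, rfl⟩
  exact integral_mono (integrable_const c) hVi fun ω => (hf ω).trans (hfV ω)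

lemma outerExp_mono (hf : ∀ ω, c ≤ f ω) (hg : ∀ ω, g ω ≤ C) (hfg : ∀ ω, f ω ≤ g ω) :
    outerExp P f ≤ outerExp P g :=
  le_outerExp hg fun _ hU hUi hgU =>
    outerExp_le_integral hf hU hUi fun ω => (hfg ω).trans (hgU ω)

lemma neg_outerExp_neg_le (hf : ∀ ω, c ≤ f ω) (hf' : ∀ ω, f ω ≤ C) :
    -outerExp P (fun ω => -f ω) ≤ outerExp P f := by
  refine le_outerExp hf' fun U _ hUi hfU => neg_le.1 ?_
  refine le_outerExp (fun ω => neg_le_neg (hf ω)) fun V _ hVi hfV => ?_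
  rw [← integral_neg]
  exact integral_mono hUi.neg hVi fun ω => (neg_le_neg (hfU ω)).trans (hfV ω)

lemma measureReal_one_le_le_outerExp (h0 : ∀ ω, 0 ≤ f ω) (hf : ∀ ω, f ω ≤ C) :
    P.real {ω | 1 ≤ f ω} ≤ outerExp P f := by
  refine le_outerExp hf fun U _ hUi hfU => ?_
  have hmarkov := mul_meas_ge_le_integral_of_nonneg
    (Eventually.of_forall fun ω => (h0 ω).trans (hfU ω)) hUi 1
  rw [one_mul] at hmarkov
  exact (measureReal_mono fun ω hω => le_trans hω (hfU ω)).trans hmarkov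

lemma outerExp_le_outerExp_add {S : Set A} {ε M : ℝ} (hε : 0 ≤ ε) (hf : ∀ ω, |f ω| ≤ M)
    (hg : ∀ ω, |g ω| ≤ M) (hfg : ∀ ω ∉ S, f ω ≤ g ω + ε) :
    outerExp P f ≤ outerExp P g + (P.real Set.univ * ε + P.real S * (2 * M)) := by
  rw [← sub_le_iff_le_add]
  refine le_outerExp (fun ω => (abs_le.1 (hg ω)).2) fun U hU hUi hgU => ?_
  rw [sub_le_iff_le_add]
  set D := toMeasurable P S
  have hD : MeasurableSet D := measurableSet_toMeasurable _ _
  have hDi : Integrable (D.indicator fun _ => 2 * M) P := (integrable_const _).indicator hD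
  have hUε : Integrable (fun ω => ε + D.indicator (fun _ => 2 * M) ω) P :=
    (integrable_const ε).add hDi
  calc outerExp P f ≤ ∫ ω, (U ω + (ε + D.indicator (fun _ => 2 * M) ω)) ∂P := by
        refine outerExp_le_integral (fun ω => (abs_le.1 (hf ω)).1)
          (hU.add (measurable_const.add (measurable_const.indicator hD))) (hUi.add hUε) fun ω => ?_
        by_cases hω : ω ∈ D
        · rw [Set.indicator_of_mem hω]
          linarith [(abs_le.1 (hf ω)).2, (abs_le.1 (hg ω)).1, hgU ω]
        · rw [Set.indicator_of_notMem hω, add_zero]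
          linarith [hfg ω fun h => hω (subset_toMeasurable P S h), hgU ω]
    _ = ∫ ω, U ω ∂P + (P.real Set.univ * ε + P.real S * (2 * M)) := by
        rw [integral_add hUi hUε, integral_add (integrable_const _) hDi, integral_const,
          integral_indicator_const _ hD, smul_eq_mul, smul_eq_mul, measureReal_def P D,
          measure_toMeasurable, measureReal_def P S]

end OuterExpectation

section LipschitzMajorant

variable {E : Type*} [PseudoMetricSpace E] (f : E →ᵇ ℝ) (K : ℝ≥0)

/-- The least `K`-Lipschitz majorant of a bounded continuous function, obtained as a
sup-convolution. It reduces statements about bounded continuous test functions to Lipschitz ones. -/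
def lipschitzMajorant (x : E) : ℝ := ⨆ z, (f z - K * dist x z)

lemma sub_mul_dist_le_norm (x z : E) : f z - K * dist x z ≤ ‖f‖ :=
  (sub_le_self _ (by positivity)).trans (f.apply_le_norm z)

lemma sub_mul_dist_le_lipschitzMajorant (x z : E) :
    f z - K * dist x z ≤ lipschitzMajorant f K x :=
  le_ciSup (f := fun z => f z - K * dist x z)
    ⟨‖f‖, Set.forall_mem_range.2 (sub_mul_dist_le_norm f K x)⟩ z

lemma le_lipschitzMajorant (x : E) : f x ≤ lipschitzMajorant f K x := by
  simpa using sub_mul_dist_le_lipschitzMajorant f K x x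

lemma abs_lipschitzMajorant_le (x : E) : |lipschitzMajorant f K x| ≤ ‖f‖ := by
  have : Nonempty E := ⟨x⟩
  exact abs_le.2 ⟨(f.neg_norm_le_apply x).trans (le_lipschitzMajorant f K x),
    ciSup_le (sub_mul_dist_le_norm f K x)⟩

lemma lipschitzWith_lipschitzMajorant : LipschitzWith K (lipschitzMajorant f K) := by
  refine LipschitzWith.of_le_add_mul K fun x y => ?_
  have : Nonempty E := ⟨x⟩
  refine ciSup_le fun z => ?_
  have htri := mul_le_mul_of_nonneg_left (dist_triangle_left y z x) K.coe_nonneg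
  have hz := sub_mul_dist_le_lipschitzMajorant f K y z
  rw [mul_add] at htri
  linarith

lemma tendsto_lipschitzMajorant (x : E) :
    Tendsto (fun m : ℕ => lipschitzMajorant f m x) atTop (𝓝 (f x)) := by
  have : Nonempty E := ⟨x⟩
  refine tendsto_order.2 ⟨fun a ha => Eventually.of_forall fun m =>
    ha.trans_le (le_lipschitzMajorant f m x), fun a ha => ?_⟩
  obtain ⟨b, hb, hba⟩ := exists_between ha
  obtain ⟨η, hη, hball⟩ := Metric.eventually_nhds_iff.1
    (f.continuous.continuousAt.eventually_lt_const hb)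
  filter_upwards [eventually_ge_atTop ⌈2 * ‖f‖ / η⌉₊] with m hm
  have hmη : 2 * ‖f‖ ≤ m * η := (div_le_iff₀ hη).1 (Nat.ceil_le.1 hm)
  refine lt_of_le_of_lt (ciSup_le fun z => ?_) hba
  rw [NNReal.coe_natCast]
  rcases lt_or_ge (dist z x) η with hnear | hfar
  · exact (sub_le_self _ (by positivity)).trans (hball hnear).le
  · have hmz : m * η ≤ m * dist x z := by
      rw [dist_comm]
      gcongr
    linarith [f.apply_le_norm z, f.neg_norm_le_apply x]

end LipschitzMajorant

section WeakConvergence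

variable {E : Type*} [PseudoMetricSpace E] {Ω' : Type*} [MeasurableSpace Ω'] {Q : Measure Ω'}
  {Y : Ω' → E}

lemma measurable_continuous_comp (hY : Measurable[_, borel E] Y) {F : Type*} [TopologicalSpace F]
    {φ : E → F} (hφ : Continuous φ) : Measurable[_, borel F] fun ω => φ (Y ω) :=
  Measurable.comp hφ.borel_measurable hY

lemma measurable_continuous_comp_real (hY : Measurable[_, borel E] Y) {φ : E → ℝ}
    (hφ : Continuous φ) : Measurable fun ω => φ (Y ω) := by
  borelize ℝ
  exact measurable_continuous_comp hY hφ

lemma exists_lipschitz_integral_lt [IsFiniteMeasure Q] (hY : Measurable[_, borel E] Y)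
    (f : E →ᵇ ℝ) {r : ℝ} (hr : ∫ ω, f (Y ω) ∂Q < r) :
    ∃ (K : ℝ≥0) (g : E →ᵇ ℝ), LipschitzWith K g ∧ (∀ x, f x ≤ g x) ∧ ∫ ω, g (Y ω) ∂Q < r := by
  have hcont (m : ℕ) : Continuous (lipschitzMajorant f m) :=
    (lipschitzWith_lipschitzMajorant f m).continuous
  have hlim : Tendsto (fun m : ℕ => ∫ ω, lipschitzMajorant f m (Y ω) ∂Q) atTop
      (𝓝 (∫ ω, f (Y ω) ∂Q)) :=
    tendsto_integral_of_dominated_convergence (fun _ => ‖f‖)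
      (fun m => (measurable_continuous_comp_real hY (hcont m)).aestronglyMeasurable)
      (integrable_const _) (fun m => Eventually.of_forall fun ω => abs_lipschitzMajorant_le f m _)
      (Eventually.of_forall fun ω => tendsto_lipschitzMajorant f _)
  obtain ⟨m, hm⟩ := (hlim.eventually_lt_const hr).exists
  exact ⟨m, .ofNormedAddCommGroup _ (hcont m) ‖f‖ (abs_lipschitzMajorant_le f m),
    lipschitzWith_lipschitzMajorant f m, le_lipschitzMajorant f m, hm⟩

variable {Ω : ℕ → Type*} [∀ n, MeasurableSpace (Ω n)] {P : ∀ n, Measure (Ω n)}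
  {X X' : ∀ n, Ω n → E}

lemma WeakConv.congr (h : WeakConv P X Q Y) (hX : ∀ᶠ n in atTop, X n = X' n) :
    WeakConv P X' Q Y :=
  ⟨h.1, fun f => (h.2 f).congr' (hX.mono fun n hn => by rw [hn])⟩

theorem WeakConv.comp_continuous {E' : Type*} [PseudoMetricSpace E'] (h : WeakConv P X Q Y)
    {φ : E → E'} (hφ : Continuous φ) :
    WeakConv P (fun n ω => φ (X n ω)) Q (fun ω => φ (Y ω)) :=
  ⟨measurable_continuous_comp h.1 hφ, fun f => h.2 (f.compContinuous ⟨φ, hφ⟩)⟩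

section Tightness

variable [∀ n, IsFiniteMeasure (P n)]

lemma WeakConv.eventually_measure_one_le_le (h : WeakConv P X Q Y) {φ : E → ℝ}
    (hφ : Continuous φ) (hφ0 : ∀ x, 0 ≤ φ x) {r : ℝ} (hr : ∫ ω, min 1 (φ (Y ω)) ∂Q < r) :
    ∀ᶠ n in atTop, P n {ω | 1 ≤ φ (X n ω)} ≤ ENNReal.ofReal r := by
  have hmin (x : E) : 0 ≤ min 1 (φ x) := le_min zero_le_one (hφ0 x)
  have hlim := h.2 (.ofNormedAddCommGroup (fun x => min 1 (φ x)) (continuous_const.min hφ) 1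
    fun x => by
      rw [Real.norm_eq_abs, abs_of_nonneg (hmin x)]
      exact min_le_left _ _)
  filter_upwards [hlim.eventually_lt_const hr] with n hn
  have hmarkov := measureReal_one_le_le_outerExp (P := P n) (f := fun ω => min 1 (φ (X n ω)))
    (fun ω => hmin _) (fun ω => min_le_left _ _)
  simp only [le_min_iff, le_refl, true_and] at hmarkov
  rw [← ofReal_measureReal]
  exact ENNReal.ofReal_le_ofReal (hmarkov.trans hn.le)

lemma WeakConv.exists_eventually_measure_one_le_le [IsFiniteMeasure Q] (h : WeakConv P X Q Y)
    {φ : ℕ → E → ℝ} (hφ : ∀ m, Continuous (φ m)) (hφ0 : ∀ m x, 0 ≤ φ m x)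
    (hlim : ∀ ω, Tendsto (fun m => φ m (Y ω)) atTop (𝓝 0)) {r : ℝ} (hr : 0 < r) :
    ∃ m, ∀ᶠ n in atTop, P n {ω | 1 ≤ φ m (X n ω)} ≤ ENNReal.ofReal r := by
  have hint : Tendsto (fun m => ∫ ω, min 1 (φ m (Y ω)) ∂Q) atTop (𝓝 (∫ _, (0 : ℝ) ∂Q)) := by
    refine tendsto_integral_of_dominated_convergence (fun _ => 1) (fun m => ?_)
      (integrable_const _) (fun m => Eventually.of_forall fun ω => ?_)
      (Eventually.of_forall fun ω => ?_)
    · exact (measurable_continuous_comp_real h.1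
        (continuous_const.min (hφ m))).aestronglyMeasurable
    · rw [Real.norm_eq_abs, abs_of_nonneg (le_min zero_le_one (hφ0 _ _))]
      exact min_le_left _ _
    · simpa using (tendsto_const_nhds (x := (1 : ℝ))).min (hlim ω)
  rw [integral_zero] at hint
  obtain ⟨m, hm⟩ := (hint.eventually_lt_const hr).exists
  exact ⟨m, h.eventually_measure_one_le_le (hφ m) (hφ0 m) hm⟩

end Tightness

section Slutsky

variable [∀ n, IsProbabilityMeasure (P n)]

lemma WeakConv.eventually_outerExp_lt_of_lipschitzWith (h : WeakConv P X Q Y)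
    (hd : IsLittleOP P fun n ω => edist (X n ω) (X' n ω)) {K : ℝ≥0} {g : E →ᵇ ℝ}
    (hg : LipschitzWith K g) {r : ℝ} (hr : ∫ ω, g (Y ω) ∂Q < r) :
    ∀ᶠ n in atTop, outerExp (P n) (fun ω => g (X' n ω)) < r := by
  set ε := (r - ∫ ω, g (Y ω) ∂Q) / (K + 1)
  have hε : 0 < ε := div_pos (sub_pos.2 hr) (by positivity)
  have hKε : (K + 1) * ε = r - ∫ ω, g (Y ω) ∂Q := mul_div_cancel₀ _ (by positivity)
  set S := fun n => {ω | ENNReal.ofReal ε ≤ edist (X n ω) (X' n ω)}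
  have hS : Tendsto (fun n => (P n).real (S n)) atTop (𝓝 0) :=
    (ENNReal.tendsto_toReal ENNReal.zero_ne_top).comp (hd _ (ENNReal.ofReal_pos.2 hε))
  have hlim : Tendsto (fun n => outerExp (P n) (fun ω => g (X n ω)) +
      (1 * (K * ε) + (P n).real (S n) * (2 * ‖g‖))) atTop
      (𝓝 (∫ ω, g (Y ω) ∂Q + (1 * (K * ε) + 0 * (2 * ‖g‖)))) :=
    (h.2 g).add ((hS.mul_const _).const_add _)
  have hlt : ∫ ω, g (Y ω) ∂Q + (1 * (K * ε) + 0 * (2 * ‖g‖)) < r := by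
    rw [add_one_mul] at hKε
    linarith
  filter_upwards [hlim.eventually_lt_const hlt] with n hn
  rw [← probReal_univ (μ := P n)] at hn
  refine (outerExp_le_outerExp_add (by positivity) (fun ω => g.norm_coe_le_norm _)
    (fun ω => g.norm_coe_le_norm _) fun ω hω => ?_).trans_lt hn
  have hclose : dist (X' n ω) (X n ω) < ε := by
    rw [dist_comm]
    exact edist_lt_ofReal.1 (not_le.1 hω)
  have hlip := (le_abs_self _).trans (hg.dist_le_mul (X' n ω) (X n ω))
  linarith [mul_le_mul_of_nonneg_left hclose.le K.coe_nonneg]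

theorem WeakConv.of_isLittleOP_edist [IsFiniteMeasure Q] (h : WeakConv P X Q Y)
    (hd : IsLittleOP P fun n ω => edist (X n ω) (X' n ω)) : WeakConv P X' Q Y := by
  have hupper (f : E →ᵇ ℝ) {r : ℝ} (hr : ∫ ω, f (Y ω) ∂Q < r) :
      ∀ᶠ n in atTop, outerExp (P n) (fun ω => f (X' n ω)) < r := by
    obtain ⟨K, g, hg, hfg, hgr⟩ := exists_lipschitz_integral_lt h.1 f hr
    filter_upwards [h.eventually_outerExp_lt_of_lipschitzWith hd hg hgr] with n hn
    exact (outerExp_mono (fun ω => f.neg_norm_le_apply _) (fun ω => g.apply_le_norm _)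
      fun ω => hfg _).trans_lt hn
  refine ⟨h.1, fun f => tendsto_order.2 ⟨fun a ha => ?_, fun a ha => hupper f ha⟩⟩
  have hneg : ∫ ω, (-f) (Y ω) ∂Q < -a := by
    simpa only [BoundedContinuousFunction.coe_neg, Pi.neg_apply, integral_neg] using neg_lt_neg ha
  filter_upwards [hupper (-f) hneg] with n hn
  exact (lt_neg.1 hn).trans_le
    (neg_outerExp_neg_le (fun ω => f.neg_norm_le_apply _) fun ω => f.apply_le_norm _)

end Slutsky

end WeakConvergence

section Linf

variable {d : ℕ} {S T : Set (Fin d → ℝ)} {f g : (Fin d → ℝ) → ℝ}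

lemma supNorm_le_ofReal_iff {C : ℝ} (hC : 0 ≤ C) :
    supNorm S f ≤ ENNReal.ofReal C ↔ ∀ x ∈ S, |f x| ≤ C := by
  simp only [supNorm, iSup₂_le_iff, ← ofReal_norm, ENNReal.ofReal_le_ofReal_iff hC,
    Real.norm_eq_abs]

lemma bddOnSet_iff : BddOnSet S f ↔ ∃ C, ∀ x ∈ S, |f x| ≤ C := by
  simp only [BddOnSet, memℓp_infty_iff, bddAbove_def, Set.forall_mem_range, Subtype.forall,
    Real.norm_eq_abs]

lemma BddOnSet.mono (h : BddOnSet T f) (hST : S ⊆ T) : BddOnSet S f := by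
  obtain ⟨C, hC⟩ := bddOnSet_iff.1 h
  exact bddOnSet_iff.2 ⟨C, fun x hx => hC x (hST hx)⟩

lemma toLinf_apply (h : BddOnSet S f) (x : S) : toLinf S f x = f x := by
  rw [toLinf, dif_pos h]

lemma abs_apply_le_norm (w : Linf S) (x : S) : |w x| ≤ ‖w‖ :=
  lp.norm_apply_le_norm ENNReal.top_ne_zero w x

lemma BddOnSet.abs_le_norm_toLinf (h : BddOnSet S f) {x : Fin d → ℝ} (hx : x ∈ S) :
    |f x| ≤ ‖toLinf S f‖ := by
  simpa only [toLinf_apply h] using abs_apply_le_norm (toLinf S f) ⟨x, hx⟩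

lemma edist_toLinf_le (hf : BddOnSet S f) (hg : BddOnSet S g) :
    edist (toLinf S f) (toLinf S g) ≤ supNorm S fun x => f x - g x := by
  by_cases htop : supNorm S (fun x => f x - g x) = ∞
  · exact htop ▸ le_top
  rw [edist_dist, dist_eq_norm, ← ENNReal.ofReal_toReal htop]
  refine ENNReal.ofReal_le_ofReal (lp.norm_le_of_forall_le ENNReal.toReal_nonneg fun x => ?_)
  rw [lp.coeFn_sub, Pi.sub_apply, toLinf_apply hf, toLinf_apply hg]
  exact (supNorm_le_ofReal_iff ENNReal.toReal_nonneg).1 (ENNReal.ofReal_toReal htop).ge x x.2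

/-- The restriction map `ℓ^∞(T) → ℓ^∞(S)` for `S ⊆ T`. -/
def restrictLinf (hST : S ⊆ T) (w : Linf T) : Linf S :=
  ⟨fun x => w ⟨x, hST x.2⟩,
    memℓp_infty_iff.2 ⟨‖w‖, Set.forall_mem_range.2 fun _ => abs_apply_le_norm w _⟩⟩

lemma continuous_restrictLinf (hST : S ⊆ T) : Continuous (restrictLinf hST) := by
  refine (LipschitzWith.of_dist_le_mul (K := 1) fun v w => ?_).continuous
  rw [NNReal.coe_one, one_mul, dist_eq_norm, dist_eq_norm]
  exact lp.norm_le_of_forall_le (norm_nonneg _) fun x => abs_apply_le_norm (v - w) ⟨x, hST x.2⟩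

lemma restrictLinf_toLinf (hST : S ⊆ T) (h : BddOnSet T f) :
    restrictLinf hST (toLinf T f) = toLinf S f := by
  refine lp.ext (funext fun x => ?_)
  rw [toLinf_apply (h.mono hST)]
  exact toLinf_apply h _

/-- The modulus of continuity at `η` of a bounded function: the supremum of its increments over
pairs of points at distance at most `η`. -/
def modulus (η : ℝ) (w : Linf S) : ℝ := ⨆ p : {p : S × S // dist p.1 p.2 ≤ η}, |w p.1.1 - w p.1.2|

lemma modulus_nonneg (η : ℝ) (w : Linf S) : 0 ≤ modulus η w :=
  Real.iSup_nonneg fun _ => abs_nonneg _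

lemma abs_sub_le_modulus {η : ℝ} (w : Linf S) {x y : S} (h : dist x y ≤ η) :
    |w x - w y| ≤ modulus η w := by
  refine le_ciSup (f := fun p : {p : S × S // dist p.1 p.2 ≤ η} => |w p.1.1 - w p.1.2|)
    ⟨‖w‖ + ‖w‖, Set.forall_mem_range.2 fun p => ?_⟩ ⟨(x, y), h⟩
  exact (abs_sub _ _).trans (add_le_add (abs_apply_le_norm w _) (abs_apply_le_norm w _))

lemma BddOnSet.abs_sub_le_modulus_toLinf (h : BddOnSet S f) {η : ℝ} {x y : Fin d → ℝ}
    (hx : x ∈ S) (hy : y ∈ S) (hxy : dist x y ≤ η) : |f x - f y| ≤ modulus η (toLinf S f) := by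
  simpa only [toLinf_apply h] using
    abs_sub_le_modulus (toLinf S f) (x := ⟨x, hx⟩) (y := ⟨y, hy⟩) hxy

lemma modulus_le {η C : ℝ} {w : Linf S} (hC : 0 ≤ C)
    (h : ∀ x y : S, dist x y ≤ η → |w x - w y| ≤ C) : modulus η w ≤ C :=
  Real.iSup_le (fun p => h _ _ p.2) hC

lemma continuous_modulus (η : ℝ) : Continuous (modulus η : Linf S → ℝ) := by
  refine (LipschitzWith.of_le_add_mul (2 : ℝ≥0) fun v w => ?_).continuous
  refine modulus_le (add_nonneg (modulus_nonneg _ _) (by positivity)) fun x y hxy => ?_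
  have hdist (z : S) : |v z - w z| ≤ dist v w := by
    rw [dist_eq_norm]
    exact abs_apply_le_norm (v - w) z
  calc |v x - v y| = |(w x - w y) + (v x - w x) - (v y - w y)| := by congr 1; ring
    _ ≤ |w x - w y| + |v x - w x| + |v y - w y| :=
        (abs_sub _ _).trans (add_le_add_left (abs_add_le _ _) _)
    _ ≤ modulus η w + dist v w + dist v w :=
        add_le_add (add_le_add (abs_sub_le_modulus w hxy) (hdist x)) (hdist y)
    _ = modulus η w + (2 : ℝ≥0) * dist v w := by rw [NNReal.coe_ofNat]; ring

lemma tendsto_modulus_toLinf (hS : IsCompact S) (hf : ContinuousOn f S) (hb : BddOnSet S f) :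
    Tendsto (fun m : ℕ => modulus (1 / ((m : ℝ) + 1)) (toLinf S f)) atTop (𝓝 0) := by
  refine tendsto_order.2 ⟨fun a ha => Eventually.of_forall fun m =>
    ha.trans_le (modulus_nonneg _ _), fun a ha => ?_⟩
  obtain ⟨η, hη, hfη⟩ := Metric.uniformContinuousOn_iff.1
    (hS.uniformContinuousOn_of_continuous hf) (a / 2) (half_pos ha)
  filter_upwards [tendsto_one_div_add_atTop_nhds_zero_nat.eventually_lt_const hη] with m hm
  refine (modulus_le (half_pos ha).le fun x y hxy => ?_).trans_lt (half_lt_self ha)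
  rw [toLinf_apply hb, toLinf_apply hb]
  exact (hfη x x.2 y y.2 (lt_of_le_of_lt hxy hm)).le

end Linf

section WeakConvLinf

variable {Ω : ℕ → Type*} [∀ n, MeasurableSpace (Ω n)] {P : ∀ n, Measure (Ω n)}

lemma IsLittleOP.mono {Z Z' : ∀ n, Ω n → ℝ≥0∞} (h : IsLittleOP P Z)
    (hZ : ∀ᶠ n in atTop, ∀ ω, Z' n ω ≤ Z n ω) : IsLittleOP P Z' := fun ε hε =>
  tendsto_of_tendsto_of_tendsto_of_le_of_le' tendsto_const_nhds (h ε hε)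
    (Eventually.of_forall fun _ => zero_le)
    (hZ.mono fun _ hn => measure_mono fun ω hω => le_trans hω (hn ω))

variable {d : ℕ} {S T : Set (Fin d → ℝ)} {X X' : ∀ n, Ω n → (Fin d → ℝ) → ℝ}
  {Ω' : Type*} [MeasurableSpace Ω'] {Q : Measure Ω'} {Y : Ω' → (Fin d → ℝ) → ℝ}

lemma WeakConvLinf.mono (h : WeakConvLinf T P X Q Y) (hST : S ⊆ T) : WeakConvLinf S P X Q Y := by
  obtain ⟨hX, hY, hw⟩ := h
  refine ⟨hX.mono fun n hn ω => (hn ω).mono hST, fun ω => (hY ω).mono hST, ?_⟩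
  simp only [← restrictLinf_toLinf hST (hY _)]
  exact (hw.comp_continuous (continuous_restrictLinf hST)).congr
    (hX.mono fun n hn => funext fun ω => restrictLinf_toLinf hST (hn ω))

lemma WeakConvLinf.of_isLittleOP_supNorm [∀ n, IsProbabilityMeasure (P n)] [IsFiniteMeasure Q]
    (h : WeakConvLinf S P X Q Y) (hX' : ∀ᶠ n in atTop, ∀ ω, BddOnSet S (X' n ω))
    (hd : IsLittleOP P fun n ω => supNorm S fun x => X' n ω x - X n ω x) :
    WeakConvLinf S P X' Q Y := by
  obtain ⟨hX, hY, hw⟩ := h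
  refine ⟨hX', hY, hw.of_isLittleOP_edist (hd.mono ?_)⟩
  filter_upwards [hX, hX'] with n hn hn' ω
  rw [edist_comm]
  exact edist_toLinf_le (hn' ω) (hn ω)

variable [∀ n, IsFiniteMeasure (P n)] [IsFiniteMeasure Q]

lemma WeakConvLinf.exists_eventually_measure_le_modulus_le (h : WeakConvLinf S P X Q Y)
    (hS : IsCompact S) (hcont : ∀ ω, ContinuousOn (Y ω) S) {ε r : ℝ} (hε : 0 < ε) (hr : 0 < r) :
    ∃ η > 0, ∀ᶠ n in atTop, P n {ω | ε ≤ modulus η (toLinf S (X n ω))} ≤ ENNReal.ofReal r := by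
  obtain ⟨-, hY, hw⟩ := h
  obtain ⟨m, hm⟩ := hw.exists_eventually_measure_one_le_le
    (φ := fun m w => modulus (1 / ((m : ℝ) + 1)) w / ε)
    (fun m => (continuous_modulus _).div_const _)
    (fun m w => div_nonneg (modulus_nonneg _ _) hε.le)
    (fun ω => by simpa using (tendsto_modulus_toLinf hS (hcont ω) (hY ω)).div_const ε) hr
  simp only [one_le_div₀ hε] at hm
  exact ⟨1 / ((m : ℝ) + 1), by positivity, hm⟩

lemma WeakConvLinf.exists_eventually_measure_le_norm_le (h : WeakConvLinf S P X Q Y) {r : ℝ}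
    (hr : 0 < r) :
    ∃ M > 0, ∀ᶠ n in atTop, P n {ω | M ≤ ‖toLinf S (X n ω)‖} ≤ ENNReal.ofReal r := by
  obtain ⟨m, hm⟩ := h.2.2.exists_eventually_measure_one_le_le
    (φ := fun m w => ‖w‖ / ((m : ℝ) + 1)) (fun m => continuous_norm.div_const _)
    (fun m w => by positivity)
    (fun ω => (tendsto_natCast_atTop_atTop.atTop_add tendsto_const_nhds).const_div_atTop _) hr
  have hpos : (0 : ℝ) < m + 1 := by positivity
  simp only [one_le_div₀ hpos] at hm
  exact ⟨m + 1, hpos, hm⟩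

end WeakConvLinf

section SmoothingError

lemma abs_sub_le_add_dist_sq {α : Type*} [PseudoMetricSpace α] {S : Set α} {w : α → ℝ}
    {η O M : ℝ} (hη : 0 < η) (hO : 0 ≤ O)
    (hosc : ∀ x ∈ S, ∀ y ∈ S, dist x y ≤ η → |w x - w y| ≤ O) (hM : ∀ x ∈ S, |w x| ≤ M)
    {x y : α} (hx : x ∈ S) (hy : y ∈ S) :
    |w y - w x| ≤ O + 2 * M / η ^ 2 * dist x y ^ 2 := by
  have hM0 : 0 ≤ M := (abs_nonneg _).trans (hM x hx)
  rcases le_or_gt (dist x y) η with hnear | hfar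
  · rw [abs_sub_comm]
    exact (hosc x hx y hy hnear).trans (le_add_of_nonneg_right (by positivity))
  · calc |w y - w x| ≤ M + M := (abs_sub _ _).trans (add_le_add (hM y hy) (hM x hx))
      _ = 0 + 2 * M / η ^ 2 * η ^ 2 := by field_simp; ring
      _ ≤ O + 2 * M / η ^ 2 * dist x y ^ 2 := by gcongr

lemma abs_integral_sub_le_add_dist_sq {α : Type*} [PseudoMetricSpace α] [MeasurableSpace α]
    {μ : Measure α} [IsProbabilityMeasure μ] {S : Set α} (hS : MeasurableSet S) {w : α → ℝ}
    {η O M R : ℝ} (hη : 0 < η) (hO : 0 ≤ O)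
    (hosc : ∀ x ∈ S, ∀ y ∈ S, dist x y ≤ η → |w x - w y| ≤ O) (hM : ∀ x ∈ S, |w x| ≤ M)
    (hR : ∀ᵐ y ∂μ, |w y| ≤ R) {x : α} (hx : x ∈ S)
    (hdist : Integrable (fun y => dist x y ^ 2) μ) :
    |∫ y, (w y - w x) ∂μ| ≤
      O + 2 * M / η ^ 2 * ∫ y, dist x y ^ 2 ∂μ + (R + M) * μ.real Sᶜ := by
  have hM0 : 0 ≤ M := (abs_nonneg _).trans (hM x hx)
  have hquad : Integrable (fun y => O + 2 * M / η ^ 2 * dist x y ^ 2) μ :=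
    (integrable_const O).add (hdist.const_mul _)
  have hind : Integrable (Sᶜ.indicator fun _ => R + M) μ :=
    (integrable_const _).indicator hS.compl
  calc |∫ y, (w y - w x) ∂μ| ≤ ∫ y, |w y - w x| ∂μ := abs_integral_le_integral_abs
    _ ≤ ∫ y, (O + 2 * M / η ^ 2 * dist x y ^ 2 + Sᶜ.indicator (fun _ => R + M) y) ∂μ := by
        refine integral_mono_of_nonneg (Eventually.of_forall fun y => abs_nonneg _)
          (hquad.add hind) ?_
        filter_upwards [hR] with y hyR
        by_cases hy : y ∈ S
        · rw [Set.indicator_of_notMem (Set.notMem_compl_iff.2 hy), add_zero]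
          exact abs_sub_le_add_dist_sq hη hO hosc hM hx hy
        · rw [Set.indicator_of_mem hy]
          exact ((abs_sub _ _).trans (add_le_add hyR (hM x hx))).trans
            (le_add_of_nonneg_left (by positivity))
    _ = O + 2 * M / η ^ 2 * ∫ y, dist x y ^ 2 ∂μ + (R + M) * μ.real Sᶜ := by
        rw [integral_add hquad hind, integral_add (integrable_const _) (hdist.const_mul _),
          integral_const_mul, integral_indicator_const _ hS.compl, integral_const, probReal_univ,
          one_smul, smul_eq_mul, mul_comm (μ.real Sᶜ)]

variable {d n : ℕ} {k : ℝ} {l g : (Fin d → ℝ) → ℝ} {K : ℝ≥0}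

lemma abs_le_of_mem_cube (hl : LipschitzOnWith K l (Set.Ici 0)) {M : ℝ} (hM : 0 ≤ M)
    {y : Fin d → ℝ} (hy : y ∈ cube d M) : |l y| ≤ |l 0| + K * M := by
  have hdist : dist y 0 ≤ M := (dist_pi_le_iff hM).2 fun j => by
    rw [Pi.zero_apply, Real.dist_0_eq_abs, abs_of_nonneg (hy.1 j)]
    exact hy.2 j
  have hlip : |l y - l 0| ≤ K * M :=
    (hl.dist_le_mul y hy.1 0 Set.self_mem_Ici).trans (mul_le_mul_of_nonneg_left hdist K.coe_nonneg)
  linarith [abs_sub_abs_le_abs_sub (l y) (l 0)]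

lemma bddOnSet_betaSmooth (hk : 0 < k) (g : (Fin d → ℝ) → ℝ) (S : Set (Fin d → ℝ)) :
    BddOnSet S (betaSmooth n k g) := by
  obtain ⟨C, hC⟩ := ((finite_grid d n k).image fun y => |g y|).bddAbove
  refine bddOnSet_iff.2 ⟨C, fun x _ => ?_⟩
  rw [betaSmooth_eq_integral hk]
  simpa using norm_integral_le_of_norm_le_const (f := g) (μ := betaSmoother n k x)
    (ae_betaSmoother_mem_grid.mono fun y hy => hC ⟨y, hy, rfl⟩)

lemma bddOnSet_sqrt_mul_betaSmooth_sub (hl : LipschitzOnWith K l (Set.Ici 0)) (hk : 0 < k) {M : ℝ}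
    (hM : 0 ≤ M) (g : (Fin d → ℝ) → ℝ) :
    BddOnSet (cube d M) fun x => √k * (betaSmooth n k g x - l x) := by
  have hlbdd : BddOnSet (cube d M) l := bddOnSet_iff.2 ⟨_, fun _ hy => abs_le_of_mem_cube hl hM hy⟩
  exact ((bddOnSet_betaSmooth hk g _).sub hlbdd).const_mul _

lemma sqrt_mul_betaSmooth_sub_eq (hk : 0 < k) (g l : (Fin d → ℝ) → ℝ) (x : Fin d → ℝ) :
    √k * (betaSmooth n k g x - l x) - √k * (g x - l x) =
      ∫ y, (√k * (g y - l y) - √k * (g x - l x)) ∂betaSmoother n k x +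
        √k * ∫ y, (l y - l x) ∂betaSmoother n k x := by
  have hint (f : (Fin d → ℝ) → ℝ) : Integrable f (betaSmoother n k x) := integrable_betaSmoother f
  rw [betaSmooth_eq_integral hk, integral_sub (hint fun y => √k * (g y - l y)) (hint _),
    integral_const_mul, integral_sub (hint g) (hint l), integral_sub (hint l) (hint _)]
  simp only [integral_const, probReal_univ, one_smul]
  ring

lemma abs_sqrt_mul_sub_le (hl : LipschitzOnWith K l (Set.Ici 0)) (hk : 1 ≤ k) (hkn : k ≤ n)
    {A : ℝ} {y : Fin d → ℝ} (hy : y ∈ cube d (n / k)) (hg : |g y| ≤ A * (n / k)) :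
    |√k * (g y - l y)| ≤ (A + |l 0| + K) * n := by
  have hk0 : 0 < k := one_pos.trans_le hk
  have hnk : 1 ≤ n / k := (one_le_div hk0).2 hkn
  have hl0 : |l 0| ≤ |l 0| * (n / k) := le_mul_of_one_le_right (abs_nonneg _) hnk
  have hly := abs_le_of_mem_cube hl (zero_le_one.trans hnk) hy
  have hgl : |g y - l y| ≤ (A + |l 0| + K) * (n / k) := by
    linarith [abs_sub (g y) (l y)]
  calc |√k * (g y - l y)| = √k * |g y - l y| := by rw [abs_mul, abs_of_nonneg (Real.sqrt_nonneg _)]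
    _ ≤ k * ((A + |l 0| + K) * (n / k)) :=
        mul_le_mul (Real.sqrt_le_self_iff.2 (.inr hk)) hgl (abs_nonneg _) hk0.le
    _ = (A + |l 0| + K) * n := by field_simp

lemma abs_integral_sqrt_mul_sub_le (hl : LipschitzOnWith K l (Set.Ici 0)) (hk : 1 ≤ k)
    (hkn : k ≤ n) {δ η O M A : ℝ} (hδ : 0 ≤ δ) (hη : 0 < η) (hO : 0 ≤ O) (hA : 0 ≤ A)
    (hosc : ∀ x ∈ cube d (1 + δ), ∀ y ∈ cube d (1 + δ), dist x y ≤ η →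
      |√k * (g x - l x) - √k * (g y - l y)| ≤ O)
    (hM : ∀ x ∈ cube d (1 + δ), |√k * (g x - l x)| ≤ M)
    (hg : ∀ y ∈ cube d (n / k), |g y| ≤ A * (n / k)) {x : Fin d → ℝ} (hx : x ∈ cube d 1) :
    |∫ y, (√k * (g y - l y) - √k * (g x - l x)) ∂betaSmoother n k x| ≤
      O + 2 * M * d / η ^ 2 * (1 / k) +
        (A + |l 0| + K + M) * d * (n * Real.exp (-chernoffRate δ * k)) := by
  have hk0 : 0 < k := one_pos.trans_le hk
  have hxδ : x ∈ cube d (1 + δ) := cube_subset_cube d (le_add_of_nonneg_right hδ) hx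
  have hM0 : 0 ≤ M := (abs_nonneg _).trans (hM x hxδ)
  have hmoment : ∫ y, dist x y ^ 2 ∂betaSmoother n k x ≤ d / k := by
    refine (integral_betaSmoother_dist_sq_le hk0
      (cube_subset_cube d ((one_le_div hk0).2 hkn) hx)).trans ?_
    gcongr
    simpa using Finset.sum_le_card_nsmul Finset.univ x 1 fun j _ => hx.2 j
  have htail := measureReal_betaSmoother_compl_cube_le hk0 hkn hx hδ
  refine (abs_integral_sub_le_add_dist_sq (measurableSet_Icc (a := 0) (b := fun _ => 1 + δ)) hη hO
    hosc hM ((ae_betaSmoother_mem_cube hk0).mono fun y hy =>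
      abs_sqrt_mul_sub_le hl hk hkn hy (hg y hy)) hxδ (integrable_betaSmoother _)).trans ?_
  have hMn : M ≤ M * n := le_mul_of_one_le_right hM0 (hk.trans hkn)
  calc _ ≤ O + 2 * M / η ^ 2 * (d / k) + ((A + |l 0| + K) * n + M * n) *
        (d * Real.exp (-chernoffRate δ * k)) := by
        gcongr
        exact htail
    _ = _ := by ring

end SmoothingError

section Asymptotics

variable {k : ℕ → ℝ}

lemma tendsto_atTop_of_log_isLittleO (hlog : (fun n : ℕ => Real.log n) =o[atTop] k)
    (hk : ∀ᶠ n in atTop, 0 < k n) : Tendsto k atTop atTop := by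
  refine tendsto_atTop_mono' _ ?_ (Real.tendsto_log_atTop.comp tendsto_natCast_atTop_atTop)
  filter_upwards [hlog.bound one_pos, hk] with n hn hkn
  rw [one_mul, Real.norm_eq_abs, Real.norm_of_nonneg hkn.le] at hn
  exact (le_abs_self _).trans hn

lemma tendsto_natCast_mul_exp_neg (hlog : (fun n : ℕ => Real.log n) =o[atTop] k)
    (hk : ∀ᶠ n in atTop, 0 < k n) {c : ℝ} (hc : 0 < c) :
    Tendsto (fun n : ℕ => (n : ℝ) * Real.exp (-c * k n)) atTop (𝓝 0) := by
  refine squeeze_zero' (Eventually.of_forall fun n => by positivity) ?_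
    tendsto_inv_atTop_nhds_zero_nat
  filter_upwards [hlog.bound (half_pos hc), hk, eventually_gt_atTop 0] with n hn hkn hn0
  rw [Real.norm_eq_abs, Real.norm_of_nonneg hkn.le] at hn
  have hn0 : (0 : ℝ) < n := Nat.cast_pos.2 hn0
  calc (n : ℝ) * Real.exp (-c * k n) = Real.exp (Real.log n + -c * k n) := by
        rw [Real.exp_add, Real.exp_log hn0]
    _ ≤ Real.exp (-Real.log n) := Real.exp_le_exp.2 (by linarith [le_abs_self (Real.log n)])
    _ = (n : ℝ)⁻¹ := by rw [Real.exp_neg, Real.exp_log hn0]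

variable {d : ℕ} {l : (Fin d → ℝ) → ℝ} {K : ℝ≥0} {δ : ℝ}

lemma eventually_abs_sqrt_mul_betaSmooth_sub_le (hl : LipschitzOnWith K l (Set.Ici 0))
    (hsmooth : HasContPartials d l) (hk : ∀ᶠ n in atTop, 0 < k n ∧ k n ≤ n)
    (hlog : (fun n : ℕ => Real.log n) =o[atTop] k) (hδ : 0 < δ) {η ε A : ℝ} (hη : 0 < η)
    (hε : 0 < ε) (hA : 0 ≤ A) (M : ℝ) :
    ∀ᶠ n : ℕ in atTop, ∀ g : (Fin d → ℝ) → ℝ,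
      (∀ x ∈ cube d (1 + δ), ∀ y ∈ cube d (1 + δ), dist x y ≤ η →
        |√(k n) * (g x - l x) - √(k n) * (g y - l y)| ≤ ε / 3) →
      (∀ x ∈ cube d (1 + δ), |√(k n) * (g x - l x)| ≤ M) →
      (∀ y ∈ cube d (n / k n), |g y| ≤ A * (n / k n)) →
      ∀ x ∈ cube d 1,
        |√(k n) * (betaSmooth n (k n) g x - l x) - √(k n) * (g x - l x)| ≤ ε := by
  obtain ⟨C, hbias⟩ := exists_sqrt_mul_bias_le hl hsmooth (ε := ε / 3) (by positivity)
  have hkpos := hk.mono fun n hn => hn.1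
  have hktop := tendsto_atTop_of_log_isLittleO hlog hkpos
  have hrest : Tendsto (fun n : ℕ => 2 * M * d / η ^ 2 * (1 / k n) +
      (A + |l 0| + K + M) * d * (n * Real.exp (-chernoffRate δ * k n)) + C / √(k n))
      atTop (𝓝 0) := by
    simpa using (((hktop.const_div_atTop 1).const_mul _).add
      ((tendsto_natCast_mul_exp_neg hlog hkpos (chernoffRate_pos hδ)).const_mul _)).add
      ((Real.tendsto_sqrt_atTop.comp hktop).const_div_atTop C)
  filter_upwards [hk, hktop.eventually_ge_atTop 1,
    hrest.eventually_lt_const (show 0 < ε / 3 by positivity)]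
    with n ⟨hkn0, hkn⟩ hk1 hrest g hosc hM hg x hx
  have hincrement := abs_integral_sqrt_mul_sub_le hl hk1 hkn hδ.le hη (by positivity) hA hosc hM
    hg hx
  have hbias := hbias n (k n) hkn0 hkn x hx
  rw [sqrt_mul_betaSmooth_sub_eq hkn0]
  refine (abs_add_le _ _).trans ?_
  rw [abs_mul, abs_of_nonneg (Real.sqrt_nonneg _)]
  linarith

variable {Ω : ℕ → Type*} [∀ n, MeasurableSpace (Ω n)] {P : ∀ n, Measure (Ω n)}

lemma isLittleOP_of_forall_eventually_measure_le {Z : ∀ n, Ω n → ℝ≥0∞}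
    (h : ∀ ε > 0, ∀ r > 0, ∀ᶠ n in atTop,
      P n {ω | ENNReal.ofReal ε < Z n ω} ≤ ENNReal.ofReal r) :
    IsLittleOP P Z := by
  intro ε hε
  obtain ⟨e, -, he, heε⟩ := ENNReal.lt_iff_exists_real_btwn.1 hε
  refine ENNReal.tendsto_nhds_zero.2 fun q hq => ?_
  obtain ⟨r, -, hr, hrq⟩ := ENNReal.lt_iff_exists_real_btwn.1 hq
  filter_upwards [h e (ENNReal.ofReal_pos.1 he) r (ENNReal.ofReal_pos.1 hr)] with n hn
  exact (measure_mono fun ω hω => heε.trans_le hω).trans (hn.trans hrq.le)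

theorem isLittleOP_supNorm_sqrt_mul_betaSmooth_sub [∀ n, IsFiniteMeasure (P n)]
    {lhat : ∀ n, Ω n → (Fin d → ℝ) → ℝ} {Ω' : Type*} [MeasurableSpace Ω'] {Q : Measure Ω'}
    [IsFiniteMeasure Q] {B : Ω' → (Fin d → ℝ) → ℝ} (hl : LipschitzOnWith K l (Set.Ici 0))
    (hsmooth : HasContPartials d l) (hk : ∀ᶠ n in atTop, 0 < k n ∧ k n ≤ n)
    (hlog : (fun n : ℕ => Real.log n) =o[atTop] k)
    (hgrowth : IsBigOP P (fun n ω => supNorm (cube d (n / k n)) (lhat n ω)) fun n => n / k n)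
    (hδ : 0 < δ) (hBcont : ∀ ω, ContinuousOn (B ω) (cube d (1 + δ)))
    (hweak : WeakConvLinf (cube d (1 + δ)) P (fun n ω x => √(k n) * (lhat n ω x - l x)) Q B) :
    IsLittleOP P fun n ω => supNorm (cube d 1) fun x =>
      √(k n) * (betaSmooth n (k n) (lhat n ω) x - l x) - √(k n) * (lhat n ω x - l x) := by
  refine isLittleOP_of_forall_eventually_measure_le fun ε hε r hr => ?_
  have hr3 : 0 < r / 3 := by positivity
  obtain ⟨η, hη, hmodulus⟩ := hweak.exists_eventually_measure_le_modulus_le isCompact_Icc hBcont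
    (ε := ε / 3) (by positivity) hr3
  obtain ⟨M, -, hnorm⟩ := hweak.exists_eventually_measure_le_norm_le hr3
  obtain ⟨A, hgrowth⟩ := hgrowth (ENNReal.ofReal (r / 3)) (ENNReal.ofReal_pos.2 hr3)
  filter_upwards [hmodulus, hnorm, hgrowth, hweak.1, hk,
    eventually_abs_sqrt_mul_betaSmooth_sub_le hl hsmooth hk hlog hδ hη hε A.coe_nonneg M]
    with n hmodulus hnorm hgrowth hbdd hkn herror
  set W : Ω n → (Fin d → ℝ) → ℝ := fun ω x => √(k n) * (lhat n ω x - l x)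
  set S := cube d (1 + δ)
  have hsub : {ω | ENNReal.ofReal ε < supNorm (cube d 1) fun x =>
      √(k n) * (betaSmooth n (k n) (lhat n ω) x - l x) - √(k n) * (lhat n ω x - l x)} ⊆
      {ω | ε / 3 ≤ modulus η (toLinf S (W ω))} ∪ {ω | M ≤ ‖toLinf S (W ω)‖} ∪
        {ω | A * ENNReal.ofReal (n / k n) < supNorm (cube d (n / k n)) (lhat n ω)} := by
    intro ω hω
    by_contra hgood
    simp only [Set.mem_union, Set.mem_ofPred_eq, not_or, not_le, not_lt] at hgood
    obtain ⟨⟨hmod, hM⟩, hA⟩ := hgood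
    rw [← ENNReal.ofReal_coe_nnreal, ← ENNReal.ofReal_mul A.coe_nonneg,
      supNorm_le_ofReal_iff (by have := hkn.1; positivity)] at hA
    exact hω.not_ge ((supNorm_le_ofReal_iff hε.le).2 (herror _
      (fun x hx y hy hxy => ((hbdd ω).abs_sub_le_modulus_toLinf hx hy hxy).trans hmod.le)
      (fun x hx => ((hbdd ω).abs_le_norm_toLinf hx).trans hM.le) hA))
  calc _ ≤ ENNReal.ofReal (r / 3) + ENNReal.ofReal (r / 3) + ENNReal.ofReal (r / 3) :=
        (measure_mono hsub).trans <| (measure_union_le _ _).trans <|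
          add_le_add ((measure_union_le _ _).trans (add_le_add hmodulus hnorm)) hgrowth
    _ = ENNReal.ofReal r := by
        rw [← ENNReal.ofReal_add hr3.le hr3.le, ← ENNReal.ofReal_add (by positivity) hr3.le,
          add_thirds]

end Asymptotics

end BetaStdf

end

theorem mainTheorem1_general {d : ℕ} {Ω : ℕ → Type*} [∀ n, MeasurableSpace (Ω n)]
    {P : ∀ n, Measure (Ω n)} [∀ n, IsProbabilityMeasure (P n)] {l : (Fin d → ℝ) → ℝ} {K : ℝ≥0}
    (hl : LipschitzOnWith K l (Set.Ici 0)) {k : ℕ → ℝ} (hk : ∀ᶠ n in atTop, 0 < k n ∧ k n ≤ n)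
    (hlog : (fun n : ℕ => Real.log n) =o[atTop] k) {lhat : ∀ n, Ω n → (Fin d → ℝ) → ℝ}
    (hsmooth : BetaStdf.HasContPartials d l)
    (hgrowth : BetaStdf.IsBigOP P
      (fun n ω => BetaStdf.supNorm (BetaStdf.cube d ((n : ℝ) / k n)) (lhat n ω))
      (fun n => (n : ℝ) / k n))
    {δ : ℝ} (hδ : 0 < δ) {Ω' : Type*} [MeasurableSpace Ω'] {Q : Measure Ω'} [IsFiniteMeasure Q]
    {B : Ω' → (Fin d → ℝ) → ℝ} (hBcont : ∀ ω, ContinuousOn (B ω) (BetaStdf.cube d (1 + δ)))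
    (hweak : BetaStdf.WeakConvLinf (BetaStdf.cube d (1 + δ)) P
      (fun n ω x => √(k n) * (lhat n ω x - l x)) Q B) :
    BetaStdf.IsLittleOP P
      (fun n ω => BetaStdf.supNorm (BetaStdf.cube d 1) (fun x =>
        √(k n) * (BetaStdf.betaSmooth n (k n) (lhat n ω) x - l x)
          - √(k n) * (lhat n ω x - l x))) ∧
    BetaStdf.WeakConvLinf (BetaStdf.cube d 1) P
      (fun n ω x => √(k n) * (lhat n ω x - l x)) Q B ∧
    BetaStdf.WeakConvLinf (BetaStdf.cube d 1) P
      (fun n ω x => √(k n) * (BetaStdf.betaSmooth n (k n) (lhat n ω) x - l x)) Q B := by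
  have herror := BetaStdf.isLittleOP_supNorm_sqrt_mul_betaSmooth_sub hl hsmooth hk hlog hgrowth hδ
    hBcont hweak
  have hcube := hweak.mono (BetaStdf.cube_subset_cube d (le_add_of_nonneg_right hδ.le))
  have hbdd : ∀ᶠ n in atTop, ∀ ω, BetaStdf.BddOnSet (BetaStdf.cube d 1) fun x =>
      √(k n) * (BetaStdf.betaSmooth n (k n) (lhat n ω) x - l x) :=
    hk.mono fun n hn ω => BetaStdf.bddOnSet_sqrt_mul_betaSmooth_sub hl hn.1 zero_le_one _
  exact ⟨herror, hcube, hcube.of_isLittleOP_supNorm hbdd herror⟩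

theorem mainTheorem1 (d : ℕ)
    {Ω : ℕ → Type*} [∀ n, MeasurableSpace (Ω n)]
    (P : ∀ n, Measure (Ω n)) [∀ n, IsProbabilityMeasure (P n)]
    -- the stdf
    (l : (Fin d → ℝ) → ℝ) (hl : BetaStdf.IsStdf d l)
    -- the tuning parameter
    (k : ℕ → ℝ) (hk : ∀ n : ℕ, 1 ≤ n → 0 < k n ∧ k n ≤ n)
    (hlog : (fun n : ℕ => Real.log n) =o[atTop] k)
    (hkn : k =o[atTop] (fun n : ℕ => (n : ℝ)))
    -- the pilot estimators; only their values on `[0, n / k_n]^d` matter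
    (lhat : ∀ n, Ω n → (Fin d → ℝ) → ℝ)
    -- smoothness of the stdf
    (hsmooth : BetaStdf.HasContPartials d l)
    -- growth condition on the pilot estimators
    (hgrowth : BetaStdf.IsBigOP P
      (fun n ω => BetaStdf.supNorm (BetaStdf.cube d ((n : ℝ) / k n)) (lhat n ω))
      (fun n => (n : ℝ) / k n))
    -- weak convergence of the pilot estimators on `[0, 1 + δ]^d`
    (δ : ℝ) (hδ : 0 < δ)
    {Ω' : Type*} [MeasurableSpace Ω'] (Q : Measure Ω') [IsProbabilityMeasure Q]
    (B : Ω' → (Fin d → ℝ) → ℝ)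
    (hBcont : ∀ ω, ContinuousOn (B ω) (BetaStdf.cube d (1 + δ)))
    (hweak : BetaStdf.WeakConvLinf (BetaStdf.cube d (1 + δ)) P
      (fun n ω x => √(k n) * (lhat n ω x - l x)) Q B) :
    BetaStdf.IsLittleOP P
      (fun n ω => BetaStdf.supNorm (BetaStdf.cube d 1) (fun x =>
        √(k n) * (BetaStdf.betaSmooth n (k n) (lhat n ω) x - l x)
          - √(k n) * (lhat n ω x - l x))) ∧
    BetaStdf.WeakConvLinf (BetaStdf.cube d 1) P
      (fun n ω x => √(k n) * (lhat n ω x - l x)) Q B ∧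
    BetaStdf.WeakConvLinf (BetaStdf.cube d 1) P
      (fun n ω x => √(k n) * (BetaStdf.betaSmooth n (k n) (lhat n ω) x - l x)) Q B :=
  mainTheorem1_general hl.lipschitzOnWith (eventually_atTop.2 ⟨1, hk⟩) hlog hsmooth hgrowth hδ
    hBcont hweak
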